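/- Let $\tau=\{R_1,\dots,R_p\}$ be a finite purely relational vocabulary, listed in a fixed order; all models have nonempty domains. An existential second-order (ESO) sentence over a vocabulary $\sigma$ is a formula $\exists X_1\cdots\exists X_k\,\varphi$, where $X_1,\dots,X_k\notin\sigma$ are relation variables and $\varphi$ is a first-order sentence (with equality) over $\sigma\cup\{X_1,\dots,X_k\}$. The $\tau$-sentences of the logic $\mathcal{L}_{RE}$ are the expressions $\mathrm{I}Y\,\psi$, where $Y\notin\tau$ is a unary relation symbol and $\psi$ is an ESO sentence over $\tau\cup\{Y\}$. For a $\tau$-model $\mathfrak{A}$ with domain $A$, $\mathfrak{A}\models \mathrm{I}Y\,\psi$ holds iff there is a finite set $S\neq\emptyset$ with $A\cap S=\emptyset$ such that $\mathfrak{A}^+\models\psi$, where $\mathfrak{A}^+$ is the model with domain $A\cup S$, $Y^{\mathfrak{A}^+}=S$, and $R^{\mathfrak{A}^+}=R^{\mathfrak{A}}$ for all $R\in\tau$. Given a finite $\tau$-model $\mathfrak{A}$ with $|A|=n$ and a linear ordering of $A$, put $\mathrm{enc}(\mathfrak{A})=0^{n}\cdot 1\cdot \mathrm{enc}(R_1^{\mathfrak{A}})\cdots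 \mathrm{enc}(R_p^{\mathfrak{A}})\in\{0,1\}^*$, where for a $k$-ary $R\in\tau$ the string $\mathrm{enc}(R^{\mathfrak{A}})$ has length $n^k$ and its $i$-th bit is $1$ iff the $i$-th tuple of $A^k$ in the lexicographic order belongs to $R^{\mathfrak{A}}$. The strings obtained from the various linear orderings of $A$ are the encodings of $\mathfrak{A}$. A (nondeterministic) Turing machine defines a semi-decision algorithm for a class $\mathcal{C}$ of finite $\tau$-models if, for every $w\in\{0,1\}^*$, it has an accepting run on input $w$ if and only if $w$ is some encoding of some $\mathfrak{A}\in\mathcal{C}$. Proposition. Let $\mathcal{C}$ be a class of finite $\tau$-models closed under isomorphism. Then there is a $\tau$-sentence $\chi$ of $\mathcal{L}_{RE}$ such that, for all finite $\tau$-models $\mathfrak{A}$, $\mathfrak{A}\in\mathcal{C}\iff\mathfrak{A}\models\chi$, if and only if some Turing machine defines a semi-decision algorithm for $\mathcal{C}$. -/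

import Mathlib

universe u v w

namespace LRE

open FirstOrder

/-! ### Existential second-order logic -/

/-- The vocabulary consisting of `k` relation variables, the `i`-th one of arity `ar i`. -/
def relVarLang {k : ℕ} (ar : Fin k → ℕ) : FirstOrder.Language.{0, 0} where
  Functions := fun _ => Empty
  Relations := fun n => {i : Fin k // ar i = n}

/-- Sentences `∃ X₁ … ∃ X_k φ` of existential second-order logic over `L`: `φ` is a first-order
sentence over `L` together with the (new) relation variables `X₁, …, X_k`. -/
structure ESOSentence (L : FirstOrder.Language.{v, w}) where
  numVars : ℕ
  arity : Fin numVars → ℕ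
  body : (L.sum (relVarLang arity)).Sentence

/-- Truth of an ESO sentence: some interpretation of the relation variables on the domain
makes the first-order part true. -/
def ESOSentence.Realize {L : FirstOrder.Language.{v, w}} (ψ : ESOSentence L)
    (A : Type u) [L.Structure A] : Prop :=
  ∃ _X : (relVarLang ψ.arity).Structure A, A ⊨ ψ.body

/-! ### The logic `L_RE` -/

/-- The only symbol of the vocabulary `{Y}`, a unary relation symbol. -/
inductive MarkRel : ℕ → Type
  | Y : MarkRel 1

/-- The vocabulary `{Y}`. -/
def markLang : FirstOrder.Language.{0, 0} where
  Functions := fun _ => Empty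
  Relations := MarkRel

/-- The `L`-structure on the disjoint union of `A` and `S` in which each relation symbol of `L`
has exactly the tuples that it has in `A`. -/
@[reducible]
def freshStructure (L : FirstOrder.Language.{v, w}) [L.IsRelational] (A : Type u) [L.Structure A]
    (S : Type) : L.Structure (A ⊕ S) where
  funMap := fun f _ => isEmptyElim f
  RelMap := fun R x => ∃ y, x = Sum.inl ∘ y ∧ FirstOrder.Language.Structure.RelMap R y

/-- The interpretation `Y = S` on the disjoint union of `A` and `S` (`Y`, the only symbol, is
unary, so `x` has a single entry). -/
@[reducible]
def markStructure (A : Type u) (S : Type) : markLang.Structure (A ⊕ S) where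
  funMap := fun f _ => Empty.elim f
  RelMap := fun _ x => ∀ i, ∃ s : S, x i = Sum.inr s

/-- The model `A⁺` over `L ∪ {Y}` with domain the disjoint union of `A` and `S`. -/
@[reducible]
def plusStructure (L : FirstOrder.Language.{v, w}) [L.IsRelational] (A : Type u) [L.Structure A]
    (S : Type) : (L.sum markLang).Structure (A ⊕ S) :=
  @FirstOrder.Language.sumStructure L markLang (A ⊕ S) (freshStructure L A S) (markStructure A S)

/-- Sentences `I Y ψ` of `L_RE` over `L`, where `ψ` is an ESO sentence over `L ∪ {Y}`. -/
structure Sentence (L : FirstOrder.Language.{v, w}) where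
  body : ESOSentence (L.sum markLang)

/-- `A ⊨ I Y ψ`: for some nonempty finite set `S` of fresh elements, `A⁺ ⊨ ψ`. -/
def Sentence.Realize {L : FirstOrder.Language.{v, w}} [L.IsRelational] (φ : Sentence L)
    (A : Type u) [L.Structure A] : Prop :=
  ∃ S : Type, Finite S ∧ Nonempty S ∧
    @ESOSentence.Realize (L.sum markLang) φ.body (A ⊕ S) (plusStructure L A S)

/-! ### Classes of finite models -/

/-- Finite `L`-models; as usual in model theory, the domain is nonempty. -/
structure FinModel (L : FirstOrder.Language.{v, w}) where
  carrier : Type u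
  [str : L.Structure carrier]
  [finite : Finite carrier]
  [nonempty : Nonempty carrier]

attribute [instance] FinModel.str FinModel.finite FinModel.nonempty

/-- Closure of a class of finite models under isomorphism. -/
def IsoClosed {L : FirstOrder.Language.{v, w}} (C : Set (FinModel.{u} L)) : Prop :=
  ∀ A B : FinModel.{u} L, Nonempty (A.carrier ≃[L] B.carrier) → A ∈ C → B ∈ C

/-- `C` is, among the finite models, the class defined by some sentence of `L_RE`. -/
def Definable {L : FirstOrder.Language.{v, w}} [L.IsRelational] (C : Set (FinModel.{u} L)) : Prop :=
  ∃ φ : Sentence L, ∀ A : FinModel.{u} L, A ∈ C ↔ φ.Realize A.carrier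

/-! ### Binary encodings of finite models -/

/-- All `k`-tuples over `{0, …, n-1}`, listed in lexicographic order. -/
def lexTuples (n : ℕ) : (k : ℕ) → List (Fin k → Fin n)
  | 0 => [Fin.elim0]
  | k + 1 => (List.finRange n).flatMap fun a =>
      (lexTuples n k).map fun t => (Fin.cons a t : Fin (k + 1) → Fin n)

open Classical in
/-- The encoding of the relation `R` on `A` as a string of `n ^ k` bits. The linear ordering of
the domain is given by its increasing enumeration `e 0 < e 1 < … < e (n-1)`. -/
noncomputable def encRel {L : FirstOrder.Language.{v, w}} {A : Type u} [L.Structure A] {n : ℕ}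
    (e : Fin n ≃ A) {k : ℕ} (R : L.Relations k) : List Bool :=
  (lexTuples n k).map fun t => decide (FirstOrder.Language.Structure.RelMap R fun i => e (t i))

/-- The encoding `0ⁿ 1 enc(R₁) … enc(R_p)` of the model `A` with respect to the ordering of the
domain given by `e` and the ordering `R₁, …, R_p` of the vocabulary given by `ord`. -/
noncomputable def enc {L : FirstOrder.Language.{v, w}} {p : ℕ} (ord : Fin p ≃ Σ k, L.Relations k)
    {A : Type u} [L.Structure A] {n : ℕ} (e : Fin n ≃ A) : List Bool :=
  List.replicate n false ++ [true] ++
    (List.finRange p).flatMap fun i => encRel e (ord i).2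

/-! ### Turing machines -/

/-- Nondeterministic single-tape Turing machines with input alphabet `{0, 1}`. The blank symbol
is `default`. If `(q', b, d) ∈ trans q a`, then in state `q` reading `a` the machine may enter
state `q'`, replace `a` by `b` and move the head as `d` says (`none`: the head stays). -/
structure TuringMachine where
  State : Type
  Symbol : Type
  [finState : Finite State]
  [finSymbol : Finite Symbol]
  [blank : Inhabited Symbol]
  input : Bool → Symbol
  input_injective : Function.Injective input
  input_ne_blank : ∀ b, input b ≠ default
  start : State
  accept : Set State
  trans : State → Symbol → Set (State × Symbol × Option Turing.Dir)

attribute [instance] TuringMachine.finState TuringMachine.finSymbol TuringMachine.blank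

namespace TuringMachine

/-- Configurations: a state and a two-way infinite tape with its head position. -/
structure Config (M : TuringMachine) where
  state : M.State
  tape : Turing.Tape M.Symbol

/-- One step of a run. -/
def Step (M : TuringMachine) (c c' : M.Config) : Prop :=
  ∃ b d, (c'.state, b, d) ∈ M.trans c.state c.tape.head ∧
    c'.tape = match d with
      | none => c.tape.write b
      | some d => (c.tape.write b).move d

/-- The initial configuration: the input word is on the tape, the head is on its first letter. -/
def init (M : TuringMachine) (x : List Bool) : M.Config where
  state := M.start
  tape := Turing.Tape.mk₁ (x.map M.input)

/-- There is an accepting run on input `x`, that is, a finite run from the initial configuration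
to an accepting state. -/
def Accepts (M : TuringMachine) (x : List Bool) : Prop :=
  ∃ c : M.Config, Relation.ReflTransGen M.Step (M.init x) c ∧ c.state ∈ M.accept

/-- `M` defines a semi-decision algorithm for the class `C` of finite models: it has an accepting
run on `x` exactly when `x` is some encoding of some model in `C`. -/
def SemiDecides (M : TuringMachine) {L : FirstOrder.Language.{v, w}} {p : ℕ}
    (ord : Fin p ≃ Σ k, L.Relations k) (C : Set (FinModel.{u} L)) : Prop :=
  ∀ x : List Bool, M.Accepts x ↔
    ∃ A ∈ C, ∃ (n : ℕ) (e : Fin n ≃ A.carrier), x = enc ord e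

end TuringMachine

end LRE

/-! From logic to machines: finite data (the sizes of `A` and `S`, the tuples of the relations of
`A`, the tuples of the relation variables) describe `A⁺` together with witnesses for the
second-order quantifiers. Truth of a fixed first-order sentence in the described model is a
primitive recursive property of the data (`exists_primrecRel_realize_plus`), and so is the claim
that a given word is the encoding of the described model (`primrec_listEnc`). The encodings of the
models of `I Y ψ` thus form a projection of a primitive recursive relation. Unbounded search makes
this projection the domain of a partial recursive function, which `exists_turingMachine_of_partrec`
turns into a machine.

From machines to logic: an accepting run is finite, so its space-time diagram fits on `A ∪ S` once
`S` is large enough. No bound on time or space in terms of `A` is needed, because the size of `S` is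
free. The elements serve both as times and as tape positions, along a linear order that is guessed;
the restriction of this order to `A` selects the encoding on which the machine runs. The other
relation variables hold the contents of the cells and the positions of the input bits, and that all
of these form a diagram (`IsDiagram`) is first-order expressible
(`DiagramVocabulary.realize_sentence`).

A run is read off a diagram by `IsDiagram.accepts`, and a diagram is drawn from a run by
`exists_isDiagram`. Together they give `realize_acceptanceSentence`: the sentence holds in `A` iff
some encoding of `A` is accepted. An encoding determines its model up to isomorphism
(`nonempty_equiv_of_enc_eq`), so closure under isomorphism then yields membership in the class. -/

namespace LRE

open Turing

/-! ### Turing machines from partial recursive functions -/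

section Compile

variable {Γ Λ : Type} [Inhabited Γ]

/-- The control states of the machine that first writes two symbols to the left of its input and
then runs a deterministic machine with set of labels `S`. -/
inductive PrefixState (S : Set Λ) : Type
  | first
  | second
  | third
  | run (q : S)
  | done

instance PrefixState.finite (S : Set Λ) [Finite S] : Finite (PrefixState S) := by
  have : Function.Injective (fun s : PrefixState S =>
      (match s with
        | .first => Sum.inl 0
        | .second => Sum.inl 1
        | .third => Sum.inl 2
        | .done => Sum.inl 3
        | .run q => Sum.inr q : Fin 4 ⊕ S)) := by
    intro a b h
    cases a <;> cases b <;> simp_all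
  exact Finite.of_injective _ this

/-- The transitions of the machine that writes `b` and then `a` to the left of the input and then
runs `M` from label `q₀`. -/
inductive PrefixTrans [Inhabited Λ] (M : TM0.Machine Γ Λ) (S : Set Λ) (q₀ : S) (a b : Γ) :
    PrefixState S → Γ → PrefixState S → Γ → Option Dir → Prop
  | first (s) : PrefixTrans M S q₀ a b .first s .second s (some .left)
  | second (s) : PrefixTrans M S q₀ a b .second s .third b (some .left)
  | third (s) : PrefixTrans M S q₀ a b .third s (.run q₀) a none
  | move (q q' : S) (s d) (h : M q s = some (q'.1, TM0.Stmt.move d)) :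
      PrefixTrans M S q₀ a b (.run q) s (.run q') s (some d)
  | write (q q' : S) (s s') (h : M q s = some (q'.1, TM0.Stmt.write s')) :
      PrefixTrans M S q₀ a b (.run q) s (.run q') s' none
  | halt (q : S) (s) (h : M q s = none) : PrefixTrans M S q₀ a b (.run q) s .done s none

/-- The Turing machine that writes `b` and then `a` to the left of the input and then runs `M`. -/
def prefixMachine [Inhabited Λ] [Finite Γ] (M : TM0.Machine Γ Λ) (S : Finset Λ)
    (hS : TM0.Supports M (S : Set Λ)) (a b : Γ) (input : Bool → Γ)
    (hinj : Function.Injective input) (hblank : ∀ c, input c ≠ default) : TuringMachine where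
  State := PrefixState (S : Set Λ)
  Symbol := Γ
  input := input
  input_injective := hinj
  input_ne_blank := hblank
  start := .first
  accept := {.done}
  trans := fun q s => {r | PrefixTrans M (S : Set Λ) ⟨default, hS.1⟩ a b q s r.1 r.2.1 r.2.2}

/-- Three preparatory steps lay out the tape on which `M` starts, each later step copies one of `M`,
and the accepting state is entered exactly where `M` halts. -/
theorem prefixMachine_accepts [Inhabited Λ] [Finite Γ] (M : TM0.Machine Γ Λ) (S : Finset Λ)
    (hS : TM0.Supports M (S : Set Λ)) (a b : Γ) (input : Bool → Γ)
    (hinj : Function.Injective input) (hblank : ∀ c, input c ≠ default) (x : List Bool) :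
    (prefixMachine M S hS a b input hinj hblank).Accepts x ↔
      (TM0.eval M (a :: b :: x.map input)).Dom := by
  set P := prefixMachine M S hS a b input hinj hblank
  set T₁ : Tape Γ := (Tape.mk₁ (x.map input)).move .left
  have hT : ((T₁.write b).move .left).write a = Tape.mk₁ (a :: b :: x.map input) := by
    simp only [T₁, Tape.mk₁, Tape.mk₂, Tape.move_left_mk', Tape.write_mk', ListBlank.cons_mk]
    rfl
  have dom_iff : (TM0.eval M (a :: b :: x.map input)).Dom ↔ ∃ d,
      StateTransition.Reaches (TM0.step M) (TM0.init (a :: b :: x.map input)) d ∧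
        TM0.step M d = none := by
    rw [Part.dom_iff_mem]
    constructor
    · rintro ⟨y, hy⟩
      obtain ⟨d, hd, -⟩ := (Part.mem_map_iff _).1 hy
      exact ⟨d, StateTransition.mem_eval.1 hd⟩
    · rintro ⟨d, hd⟩
      exact ⟨_, Part.mem_map _ (StateTransition.mem_eval.2 hd)⟩
  constructor
  · rintro ⟨c, hc, hacc⟩
    -- A reachable configuration belongs to one of the three preparatory stages, to the simulation
    -- of a reachable configuration of `M`, or to the time after halting.
    have inv : ∀ c, Relation.ReflTransGen P.Step (P.init x) c →
        (c = P.init x ∨ c = ⟨.second, T₁⟩ ∨ c = ⟨.third, (T₁.write b).move .left⟩ ∨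
          (∃ q T, c = ⟨.run q, T⟩ ∧ StateTransition.Reaches (TM0.step M)
            (TM0.init (a :: b :: x.map input)) ⟨q.1, T⟩) ∨
          (c.state = PrefixState.done ∧ (TM0.eval M (a :: b :: x.map input)).Dom)) := by
      intro c hc
      induction hc with
      | refl => exact Or.inl rfl
      | @tail c c' _ hstep ih =>
        obtain ⟨s, d, htr, htape⟩ := hstep
        obtain ⟨q', T'⟩ := c'
        dsimp only at htr htape
        change PrefixTrans M (S : Set Λ) ⟨default, hS.1⟩ a b c.state c.tape.head q' s d at htr
        rcases ih with rfl | rfl | rfl | ⟨q, T, rfl, hr⟩ | ⟨hd, -⟩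
        · change PrefixTrans M _ _ a b PrefixState.first _ _ _ _ at htr
          cases htr
          refine Or.inr (Or.inl ?_)
          rw [htape]
          simp only [TuringMachine.init]
          rw [Tape.write_self]
          rfl
        · cases htr
          exact Or.inr (Or.inr (Or.inl (by rw [htape]; rfl)))
        · cases htr
          refine Or.inr (Or.inr (Or.inr (Or.inl ⟨⟨default, hS.1⟩, T', rfl, ?_⟩)))
          have : T' = Tape.mk₁ (a :: b :: x.map input) := htape.trans hT
          rw [this]
          exact Relation.ReflTransGen.refl
        · cases htr with
          | move _ q' _ d h =>
            refine Or.inr (Or.inr (Or.inr (Or.inl ⟨q', T', rfl, hr.tail ?_⟩)))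
            subst htape
            simp only [TM0.step, h, Tape.write_self]
            rfl
          | write _ q' _ s' h =>
            refine Or.inr (Or.inr (Or.inr (Or.inl ⟨q', T', rfl, hr.tail ?_⟩)))
            subst htape
            simp only [TM0.step, h]
            rfl
          | halt _ _ h =>
            refine Or.inr (Or.inr (Or.inr (Or.inr ⟨rfl, dom_iff.2 ⟨_, hr, ?_⟩⟩)))
            simp only [TM0.step, h]
            rfl
        · rw [hd] at htr
          cases htr
    rcases inv c hc with rfl | rfl | rfl | ⟨q, T, rfl, hr⟩ | ⟨-, h⟩
    · cases hacc
    · cases hacc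
    · cases hacc
    · cases hacc
    · exact h
  · intro hdom
    obtain ⟨d, hd, hnone⟩ := dom_iff.1 hdom
    have step_of : ∀ (q : PrefixState (S : Set Λ)) (T : Tape Γ) q' s d,
        PrefixTrans M (S : Set Λ) ⟨default, hS.1⟩ a b q T.head q' s d →
        P.Step ⟨q, T⟩ ⟨q', match d with
          | none => T.write s
          | some d => (T.write s).move d⟩ := fun q T q' s d h => ⟨s, d, h, rfl⟩
    have reach : ∀ d, StateTransition.Reaches (TM0.step M)
        (TM0.init (a :: b :: x.map input)) d → ∃ hq : d.q ∈ (S : Set Λ),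
          Relation.ReflTransGen P.Step (P.init x) ⟨PrefixState.run ⟨d.q, hq⟩, d.Tape⟩ := by
      intro d hd
      induction hd with
      | refl =>
        refine ⟨hS.1, ?_⟩
        have h₁ := step_of .first (Tape.mk₁ (x.map input)) _ _ _ (.first _)
        have h₂ := step_of .second T₁ _ _ _ (.second _)
        have h₃ : P.Step ⟨PrefixState.third, (T₁.write b).move .left⟩
            ⟨PrefixState.run ⟨default, hS.1⟩, Tape.mk₁ (a :: b :: x.map input)⟩ :=
          ⟨a, none, .third _, hT.symm⟩
        dsimp only at h₁ h₂
        rw [Tape.write_self] at h₁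
        exact .head h₁ (.head h₂ (.single h₃))
      | @tail d d' _ hstep ih =>
        obtain ⟨hq, hr⟩ := ih
        obtain ⟨q, T⟩ := d
        obtain ⟨q', T'⟩ := d'
        have hstep : (q', T') ∈ (M q T.head).map fun r => (r.1, match r.2 with
            | .move d => T.move d
            | .write a => T.write a) := by
          simp only [TM0.step, Option.mem_def, Option.map_eq_some_iff] at hstep ⊢
          obtain ⟨r, hr, he⟩ := hstep
          refine ⟨r, hr, ?_⟩
          cases he
          rfl
        obtain ⟨⟨q₁, s⟩, hM, he⟩ := Option.map_eq_some_iff.1 hstep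
        -- A support is closed under transitions, so the simulation never leaves the finite set of
        -- labels that serve as states.
        have hq' : q₁ ∈ (S : Set Λ) := hS.2 hM hq
        obtain ⟨rfl, hT'⟩ := Prod.mk.inj he
        refine ⟨hq', hr.tail ?_⟩
        subst hT'
        cases s with
        | move d =>
          have h := step_of _ _ _ _ _ (.move ⟨q, hq⟩ ⟨q₁, hq'⟩ _ d hM)
          dsimp only at h
          rw [Tape.write_self] at h
          exact h
        | write s => exact step_of _ _ _ _ _ (.write ⟨q, hq⟩ ⟨q₁, hq'⟩ _ s hM)
    obtain ⟨hq, hr⟩ := reach d hd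
    obtain ⟨q, T⟩ := d
    refine ⟨⟨PrefixState.done, T⟩, hr.tail ⟨_, _, PrefixTrans.halt ⟨q, hq⟩ _ ?_, ?_⟩, rfl⟩
    · simpa [TM0.step] using hnone
    · exact (Tape.write_self T).symm

end Compile

/-- The positive number whose binary expansion is `1` followed by `x`. -/
def wordNum (x : List Bool) : PosNum :=
  x.foldl (fun k c => cond c k.bit1 k.bit0) .one

/-- `trPosNum` lists binary digits with the least significant one first. Read backwards, as the
stack lies on the tape, the digits of `wordNum x` are a leading `1` followed by `x` itself; hence
the input need not be rewritten, only extended on the left. -/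
theorem trPosNum_wordNum (x : List Bool) : PartrecToTM2.trPosNum (wordNum x) =
    (PartrecToTM2.Γ'.bit1 :: x.map fun c => cond c PartrecToTM2.Γ'.bit1 .bit0).reverse := by
  induction x using List.reverseRecOn with
  | nil => rfl
  | append_singleton x c ih =>
    rw [wordNum, List.foldl_append, List.foldl_cons, List.foldl_nil, ← wordNum]
    cases c <;> simp [PartrecToTM2.trPosNum, ih]

theorem wordNum_injective : Function.Injective wordNum := by
  intro x y h
  have h' := congrArg PartrecToTM2.trPosNum h
  rw [trPosNum_wordNum, trPosNum_wordNum, List.reverse_inj] at h'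
  refine (List.map_injective_iff.2 ?_) (List.cons.inj h').2
  intro a b
  cases a <;> cases b <;> simp

instance : Finite PartrecToTM2.K' := by
  have : Function.Injective (fun s : PartrecToTM2.K' =>
      (match s with | .main => 0 | .rev => 1 | .aux => 2 | .stack => 3 : Fin 4)) := by
    intro a b h
    cases a <;> cases b <;> simp_all
  exact Finite.of_injective _ this

/-- The stack machine that evaluates a code. -/
def codeStackMachine :
    PartrecToTM2.Λ' → TM2.Stmt (fun _ : PartrecToTM2.K' => PartrecToTM2.Γ') PartrecToTM2.Λ'
      (Option PartrecToTM2.Γ') :=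
  PartrecToTM2.tr

/-- The stack machine is the same for all codes: `c` enters only as the default label, at which the
computation starts. -/
theorem codeStackMachine_dom (c : ToPartrec.Code) (v : List ℕ) :
    let _ : Inhabited PartrecToTM2.Λ' := ⟨PartrecToTM2.trNormal c .halt⟩
    (TM2.eval codeStackMachine .main (PartrecToTM2.trList v)).Dom ↔ (c.eval v).Dom := by
  intro _
  have h : (TM2.init PartrecToTM2.K'.main (PartrecToTM2.trList v) :
      TM2.Cfg (fun _ : PartrecToTM2.K' => PartrecToTM2.Γ') PartrecToTM2.Λ'
        (Option PartrecToTM2.Γ')) = PartrecToTM2.init c v := by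
    have : Function.update (fun _ => []) .main (PartrecToTM2.trList v) =
        PartrecToTM2.K'.elim (PartrecToTM2.trList v) [] [] [] := by
      funext k
      cases k <;> rfl
    rw [TM2.init, PartrecToTM2.init, this]
    rfl
  have h' := congrArg Part.Dom (PartrecToTM2.tr_eval c v)
  rw [TM2.eval, h]
  exact iff_of_eq h'

/-- The tape alphabet of the single-tape version of `codeStackMachine`. -/
abbrev CodeSymbol : Type :=
  TM2to1.Γ' PartrecToTM2.K' fun _ => PartrecToTM2.Γ'

/-- The tape cell that holds `s` on the main stack, and the bottom mark if `bot` is true. -/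
def codeCell (bot : Bool) (s : PartrecToTM2.Γ') : CodeSymbol :=
  (bot, Function.update (fun _ => none) .main (some s))

theorem codeCell_injective (bot : Bool) : Function.Injective (codeCell bot) := by
  intro s t h
  have := congrFun (Prod.mk.inj h).2 PartrecToTM2.K'.main
  simpa using this

theorem codeCell_ne_default (bot : Bool) (s : PartrecToTM2.Γ') : codeCell bot s ≠ default := by
  intro h
  have := congrFun (Prod.mk.inj h).2 PartrecToTM2.K'.main
  simp at this

/-- Every partial recursive function has a Turing machine accepting the words that encode the
numbers of its domain. -/
theorem exists_turingMachine_of_partrec {f : ℕ →. ℕ} (hf : Partrec f) :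
    ∃ M : TuringMachine, ∀ x, M.Accepts x ↔ (f (wordNum x : ℕ)).Dom := by
  obtain ⟨c, hc⟩ := ToPartrec.Code.exists_code (Nat.Partrec'.part_iff₁.2 hf)
  let _ : Inhabited PartrecToTM2.Λ' := ⟨PartrecToTM2.trNormal c PartrecToTM2.Cont'.halt⟩
  have s₂ : TM2.Supports codeStackMachine (PartrecToTM2.codeSupp c .halt) :=
    PartrecToTM2.tr_supports c PartrecToTM2.Cont'.halt
  -- Both translations, to a single tape and to elementary steps, preserve the existence of a finite
  -- support, which supplies the finite state set.
  have s₀ := TM1to0.tr_supports _ (TM2to1.tr_supports _ s₂)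
  have : Finite CodeSymbol :=
    inferInstanceAs (Finite (Bool × (PartrecToTM2.K' → Option PartrecToTM2.Γ')))
  have hinj : Function.Injective fun b => codeCell false (cond b .bit1 .bit0) := by
    intro a b h
    have := codeCell_injective _ h
    cases a <;> cases b <;> simp_all
  refine ⟨prefixMachine _ _ s₀ (codeCell true .cons) (codeCell false .bit1)
    (fun b => codeCell false (cond b .bit1 .bit0)) hinj (fun _ => codeCell_ne_default _ _),
    fun x => ?_⟩
  -- The tape holds the main stack from the bottom up: the separator `cons`, carrying the bottom
  -- mark, then the leading digit, then the word. The first two are the symbols written to the left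
  -- of the input.
  have hinit : codeCell true .cons :: codeCell false .bit1 ::
      x.map (fun b => codeCell false (cond b .bit1 .bit0)) =
      TM2to1.trInit PartrecToTM2.K'.main (PartrecToTM2.trList [(wordNum x : ℕ)]) := by
    have h : (PartrecToTM2.trList [(wordNum x : ℕ)]).reverse = .cons :: .bit1 ::
        x.map fun c => cond c PartrecToTM2.Γ'.bit1 .bit0 := by
      simp [PartrecToTM2.trList, PartrecToTM2.trNat, PartrecToTM2.trNum, trPosNum_wordNum]
    rw [TM2to1.trInit, h]
    exact congrArg (fun l => codeCell true .cons :: codeCell false .bit1 :: l)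
      (List.map_map (l := x) (g := codeCell false)
        (f := fun c => cond c PartrecToTM2.Γ'.bit1 .bit0)).symm
  have hcode : (c.eval [(wordNum x : ℕ)]).Dom ↔ (f (wordNum x : ℕ)).Dom :=
    iff_of_eq (congrArg Part.Dom (hc ((wordNum x : ℕ) ::ᵥ List.Vector.nil)))
  refine (prefixMachine_accepts _ _ s₀ _ _ _ hinj (fun _ => codeCell_ne_default _ _) x).trans ?_
  rw [hinit, TM1to0.tr_eval, TM2to1.tr_eval_dom]
  exact (codeStackMachine_dom c _).trans hcode

end LRE

namespace LRE

open FirstOrder FirstOrder.Language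

/-! ### Model checking is primitive recursive -/

universe a b c

theorem exists_eq_var {L : FirstOrder.Language.{a, b}} [∀ n, IsEmpty (L.Functions n)]
    {j : ℕ} (t : L.Term (Empty ⊕ Fin j)) : ∃ i : Fin j, t = Term.var (Sum.inr i) := by
  cases t with
  | var x => rcases x with x | i
             · exact x.elim
             · exact ⟨i, rfl⟩
  | func f _ => exact isEmptyElim f

/-- For a fixed first-order formula over a relational vocabulary, satisfaction in a structure with
domain `{0, …, N - 1}` is a primitive recursive property of the data that describe the structure,
provided that its atomic formulas are. -/
theorem exists_primrecRel_realize {L : FirstOrder.Language.{a, b}}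
    [∀ n, IsEmpty (L.Functions n)] {δ : Type} [Primcodable δ] {N : δ → ℕ} (hN : Primrec N)
    (chk : ∀ k, L.Relations k → δ → List ℕ → Prop) (hchk : ∀ k R, PrimrecRel (chk k R))
    {j : ℕ} (φ : L.BoundedFormula Empty j) :
    ∃ P : δ → List ℕ → Prop, PrimrecRel P ∧
      ∀ (d : δ) (D : Type c) [L.Structure D] (g : D ≃ Fin (N d)),
        (∀ k (R : L.Relations k) (t : Fin k → D),
          Structure.RelMap R t ↔ chk k R d (List.ofFn fun i => (g (t i) : ℕ))) →
        ∀ v : Fin j → D, φ.Realize default v ↔ P d (List.ofFn fun i => (g (v i) : ℕ)) := by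
  induction φ with
  | falsum =>
    refine ⟨fun _ _ => False, ?_, fun d D _ g _ v => Iff.rfl⟩
    exact Primrec.primrecPred (p := fun _ : δ × List ℕ => False)
      ((Primrec.const false).of_eq fun _ => rfl)
  | @equal j t₁ t₂ =>
    obtain ⟨i₁, rfl⟩ := exists_eq_var t₁
    obtain ⟨i₂, rfl⟩ := exists_eq_var t₂
    -- Valuations are lists of numbers. The default `0` is never reached, since a list that comes
    -- from a valuation has length `j`.
    refine ⟨fun _ l => l.getD i₁ 0 = l.getD i₂ 0, ?_, fun d D _ g _ v => ?_⟩
    · exact PrimrecRel.comp Primrec.eq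
        ((Primrec.list_getD 0).comp Primrec.snd (Primrec.const _))
        ((Primrec.list_getD 0).comp Primrec.snd (Primrec.const _))
    · simp [BoundedFormula.Realize, Fin.val_inj]
  | @rel j k R ts =>
    choose i hi using fun s => exists_eq_var (ts s)
    refine ⟨fun d l => chk k R d ((List.ofFn fun s => (i s : ℕ)).map fun n => l.getD n 0), ?_,
      fun d D _ g h v => ?_⟩
    · exact (hchk k R).comp Primrec.fst (Primrec.list_map (Primrec.const _)
        ((Primrec.list_getD 0).comp (Primrec.snd.comp Primrec.fst)
          Primrec.snd))
    · simp [BoundedFormula.Realize, h, hi, List.map_ofFn, Function.comp_def]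
  | imp φ ψ ihφ ihψ =>
    obtain ⟨P, hP, h⟩ := ihφ
    obtain ⟨Q, hQ, h'⟩ := ihψ
    refine ⟨fun d l => ¬ P d l ∨ Q d l, PrimrecPred.or (PrimrecPred.not hP) hQ,
      fun d D _ g hD v => ?_⟩
    rw [BoundedFormula.realize_imp, h d D g hD, h' d D g hD, imp_iff_not_or]
  | @all j φ ih =>
    obtain ⟨P, hP, h⟩ := ih
    have hR : PrimrecRel fun (x : ℕ) (y : δ × List ℕ) => P y.1 (y.2 ++ [x]) :=
      hP.comp (Primrec.fst.comp Primrec.snd)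
        (Primrec.list_concat.comp (Primrec.snd.comp Primrec.snd) Primrec.fst)
    -- Over a domain with `N d` elements the quantifier is a bounded one, which preserves primitive
    -- recursiveness.
    have hall : PrimrecPred fun q : δ × List ℕ =>
        ∀ x ∈ List.range (N q.1), P q.1 (q.2 ++ [x]) :=
      PrimrecRel.comp (R := fun (r : List ℕ) (y : δ × List ℕ) => ∀ x ∈ r, P y.1 (y.2 ++ [x]))
        hR.forall_mem_list (Primrec.list_range.comp (hN.comp Primrec.fst)) Primrec.id
    refine ⟨fun d l => ∀ x ∈ List.range (N d), P d (l ++ [x]), hall, fun d D _ g hD v => ?_⟩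
    rw [BoundedFormula.realize_all]
    have key : ∀ x : D, (List.ofFn fun i => (g ((Fin.snoc v x : Fin (j + 1) → D) i) : ℕ)) =
        (List.ofFn fun i => (g (v i) : ℕ)) ++ [(g x : ℕ)] := by
      intro x
      rw [List.ofFn_succ_last]
      simp
    constructor
    · intro hx x hlt
      rw [List.mem_range] at hlt
      have := (h d D g hD _).1 (hx (g.symm ⟨x, hlt⟩))
      rw [key] at this
      simpa using this
    · intro hx x
      rw [h d D g hD, key]
      exact hx _ (List.mem_range.2 (g x).2)

/-! ### Turing machines for projections of primitive recursive relations -/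

theorem cast_wordNum (x : List Bool) :
    (wordNum x : ℕ) = x.foldl (fun k c => cond c (k + k + 1) (k + k)) 1 := by
  induction x using List.reverseRecOn with
  | nil => rfl
  | append_singleton x c ih =>
    rw [wordNum, List.foldl_append, ← wordNum, List.foldl_append, ← ih]
    cases c
    · exact PosNum.cast_bit0 _
    · exact PosNum.cast_bit1 _

theorem primrec_wordNum : Primrec fun x : List Bool => (wordNum x : ℕ) := by
  have hd : Primrec₂ fun (_ : List Bool) (q : ℕ × Bool) => q.1 + q.1 :=
    (Primrec.nat_add.comp (Primrec.fst.comp Primrec.snd) (Primrec.fst.comp Primrec.snd)).to₂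
  have : Primrec fun x : List Bool =>
      x.foldl (fun k c => cond c (k + k + 1) (k + k)) 1 :=
    Primrec.list_foldl Primrec.id (Primrec.const 1)
      (h := fun _ q => cond q.2 (q.1 + q.1 + 1) (q.1 + q.1))
      (Primrec.cond (Primrec.snd.comp Primrec.snd) (Primrec.succ.comp hd) hd)
  exact this.of_eq fun x => (cast_wordNum x).symm

/-- The projection of a primitive recursive relation is accepted by a Turing machine. -/
theorem exists_turingMachine_of_primrecRel {δ : Type} [Primcodable δ] {Q : List Bool → δ → Prop}
    (hQ : PrimrecRel Q) : ∃ M : TuringMachine, ∀ x, M.Accepts x ↔ ∃ d, Q x d := by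
  classical
  -- The number `s` codes a word together with a witness. Carrying the word along makes it
  -- unnecessary to invert `wordNum`; injectivity identifies it afterwards.
  let R : ℕ → ℕ → Prop := fun k s =>
    ∃ w ∈ (Encodable.decode (α := List Bool × δ) s).toList, (wordNum w.1 : ℕ) = k ∧ Q w.1 w.2
  have hR : PrimrecRel R := by
    have h : PrimrecRel fun (w : List Bool × δ) (k : ℕ) => (wordNum w.1 : ℕ) = k ∧ Q w.1 w.2 :=
      PrimrecPred.and
        (PrimrecRel.comp Primrec.eq (primrec_wordNum.comp (Primrec.fst.comp Primrec.fst))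
          Primrec.snd)
        (hQ.comp (Primrec.fst.comp Primrec.fst) (Primrec.snd.comp Primrec.fst))
    exact h.exists_mem_list.comp
      (Primrec.optionToList.comp (Primrec.decode.comp Primrec.snd)) Primrec.fst
  have hf : Partrec fun k : ℕ => Nat.rfind fun s => Part.some (decide (R k s)) :=
    Partrec.rfind (PrimrecPred.decide hR).to_comp.partrec.to₂
  obtain ⟨M, hM⟩ := exists_turingMachine_of_partrec hf
  refine ⟨M, fun x => ?_⟩
  refine (hM x).trans (Nat.rfind_dom.trans ?_)
  constructor
  · rintro ⟨s, hs, -⟩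
    obtain ⟨⟨y, d⟩, -, hy, hd⟩ : R (wordNum x) s := by simpa using hs
    rw [PosNum.cast_inj] at hy
    exact ⟨d, wordNum_injective hy ▸ hd⟩
  · rintro ⟨d, hd⟩
    refine ⟨Encodable.encode (x, d), ?_, fun _ => trivial⟩
    have : R (wordNum x) (Encodable.encode (x, d)) := ⟨(x, d), by simp, rfl, hd⟩
    exact Part.mem_some_iff.2 (decide_eq_true this).symm

/-! ### Encodings of classes definable in `L_RE` -/

/-- The lists of length `k` over `{0, …, n-1}` in lexicographic order. -/
def lexLists (n : ℕ) : ℕ → List (List ℕ)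
  | 0 => [List.nil]
  | k + 1 => (List.range n).flatMap fun a => (lexLists n k).map (List.cons a)

/-- Lists of numbers put the tuples for all `n` into one encodable type, so that primitive
recursiveness in `n` makes sense. -/
theorem lexLists_eq (n k : ℕ) :
    lexLists n k = (lexTuples n k).map fun t => List.ofFn fun i => (t i : ℕ) := by
  induction k with
  | zero => simp [lexLists, lexTuples]
  | succ k ih =>
    rw [lexLists, lexTuples, ih, List.map_flatMap, ← List.map_coe_finRange_eq_range,
      List.flatMap_map]
    refine List.flatMap_congr fun a _ => ?_
    simp [List.map_map, Function.comp_def]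

theorem primrec_lexLists (k : ℕ) : Primrec fun n => lexLists n k := by
  induction k with
  | zero => exact Primrec.const _
  | succ k ih =>
    exact Primrec.list_flatMap Primrec.list_range (Primrec.list_map
      (g := fun (q : ℕ × ℕ) t => q.2 :: t) (ih.comp Primrec.fst)
      (Primrec.list_cons.comp (Primrec.snd.comp Primrec.fst) Primrec.snd))

theorem primrec_flatMap_const {ι α β : Type} [Primcodable α] [Primcodable β] (l : List ι)
    {f : ι → α → List β} (hf : ∀ i, Primrec (f i)) : Primrec fun a => l.flatMap fun i => f i a := by
  induction l with
  | nil => exact Primrec.const _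
  | cons i l ih => exact Primrec.list_append.comp (hf i) ih

theorem primrecRel_mem {α : Type} [Primcodable α] : PrimrecRel fun (a : α) (l : List α) => a ∈ l := by
  have h : PrimrecRel fun (l : List α) (b : α) => ∃ a ∈ l, a = b :=
    PrimrecRel.exists_mem_list Primrec.eq
  exact (h.comp Primrec.snd Primrec.fst).of_eq fun q => by simp

/-- The word that encodes the model with domain `{0, …, n-1}` in which the `i`-th relation, of
arity `ar i`, has the tuples `t` with `i :: t ∈ W`. -/
def listEnc {p : ℕ} (ar : Fin p → ℕ) (n : ℕ) (W : List (List ℕ)) : List Bool :=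
  List.replicate n false ++ [true] ++
    (List.finRange p).flatMap fun i => (lexLists n (ar i)).map fun t => decide ((i : ℕ) :: t ∈ W)

theorem primrec_listEnc {p : ℕ} (ar : Fin p → ℕ) : Primrec₂ (listEnc ar) := by
  have h₁ : Primrec fun n => List.replicate n false :=
    (Primrec.list_map (g := fun _ _ => false) Primrec.list_range (Primrec.const _).to₂).of_eq
      fun n => by simp
  refine Primrec.list_append.comp (Primrec.list_append.comp (h₁.comp Primrec.fst)
    (Primrec.const _)) (primrec_flatMap_const _ fun i => ?_)
  refine Primrec.list_map ((primrec_lexLists _).comp Primrec.fst) ?_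
  exact PrimrecPred.decide (primrecRel_mem.comp
    (Primrec.list_cons.comp (Primrec.const _) Primrec.snd) (Primrec.snd.comp Primrec.fst))

theorem enc_eq_listEnc {L : FirstOrder.Language.{a, b}} {p : ℕ}
    (ord : Fin p ≃ Σ k, L.Relations k) {A : Type c} [L.Structure A] {n : ℕ} (e : Fin n ≃ A)
    (W : List (List ℕ)) (hW : ∀ (r : Σ k, L.Relations k) (t : Fin r.1 → Fin n),
      (ord.symm r : ℕ) :: List.ofFn (fun j => (t j : ℕ)) ∈ W ↔ Structure.RelMap r.2 (e ∘ t)) :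
    enc ord e = listEnc (fun i => (ord i).1) n W := by
  rw [enc, listEnc]
  congr 1
  refine List.flatMap_congr fun i _ => ?_
  rw [encRel, lexLists_eq, List.map_map]
  refine List.map_congr_left fun t _ => ?_
  exact decide_eq_decide.2 ((hW (ord i) t).symm.trans (by rw [Equiv.symm_apply_apply]))

/-- There are finitely many relations on a finite domain, hence finitely many tuples to list;
injectivity of the indices keeps tuples of different relations apart. -/
theorem exists_list_mem_iff {ι : Type a} [Finite ι] {idx : ι → ℕ} (hidx : Function.Injective idx)
    {k : ι → ℕ} {n : ℕ} (Q : ∀ i, (Fin (k i) → Fin n) → Prop) :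
    ∃ W : List (List ℕ), ∀ i t, idx i :: List.ofFn (fun j => (t j : ℕ)) ∈ W ↔ Q i t := by
  have hfin : {l | ∃ q : Σ i, Fin (k i) → Fin n, Q q.1 q.2 ∧
      idx q.1 :: List.ofFn (fun j => (q.2 j : ℕ)) = l}.Finite :=
    (Set.toFinite {q : Σ i, Fin (k i) → Fin n | Q q.1 q.2}).image
      fun q : Σ i, Fin (k i) → Fin n => idx q.1 :: List.ofFn (fun j => (q.2 j : ℕ))
  refine ⟨hfin.toFinset.toList, fun i t => ?_⟩
  rw [Finset.mem_toList, Set.Finite.mem_toFinset]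
  constructor
  · rintro ⟨⟨i', t'⟩, hQ, h⟩
    obtain ⟨h₁, h₂⟩ := List.cons.inj h
    obtain rfl := hidx h₁
    obtain rfl : t' = t := funext fun j => Fin.ext (congrFun (List.ofFn_injective h₂) j)
    exact hQ
  · intro hQ
    exact ⟨⟨i, t⟩, hQ, rfl⟩

instance relVarLang_isRelational {k : ℕ} (ar : Fin k → ℕ) : (relVarLang ar).IsRelational :=
  fun _ => inferInstanceAs (IsEmpty Empty)

instance markLang_isRelational : markLang.IsRelational :=
  fun _ => inferInstanceAs (IsEmpty Empty)

/-- Finite data that describe a model `A⁺` together with an interpretation of relation variables: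
the sizes of the domain and of the set of new elements, the tuples in the relations of `A`, and
the tuples in the relation variables, each tuple preceded by the index of its relation. -/
abbrev ModelData : Type := (ℕ × ℕ) × List (List ℕ) × List (List ℕ)

/-! ### Truth in the expanded model `A⁺` as a property of finite data -/

section ModelData

variable {L : FirstOrder.Language.{a, b}} {p : ℕ} (ord : Fin p ≃ Σ k, L.Relations k)
  {q : ℕ} (ar : Fin q → ℕ)

/-- Truth of atomic formulas in the model described by given data. -/
def atomCheck : ∀ k, ((L.sum markLang).sum (relVarLang ar)).Relations k →
    ModelData → List ℕ → Prop
  -- The list may contain tuples with entries outside `A`; the bound discards them, as the relations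
  -- of `A⁺` hold of old elements only.
  | k, Sum.inl (Sum.inl R), d, l => (∀ x ∈ l, x < d.1.1) ∧ (ord.symm ⟨k, R⟩ : ℕ) :: l ∈ d.2.1
  | _, Sum.inl (Sum.inr _), d, l => ∀ x ∈ l, d.1.1 ≤ x
  | _, Sum.inr i, d, l => (i.1 : ℕ) :: l ∈ d.2.2

theorem primrecRel_atomCheck (k : ℕ) (R : ((L.sum markLang).sum (relVarLang ar)).Relations k) :
    PrimrecRel (atomCheck ord ar k R) := by
  have cons_mem : ∀ (i : ℕ) (f : ModelData → List (List ℕ)), Primrec f →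
      PrimrecRel fun (d : ModelData) (l : List ℕ) => i :: l ∈ f d := fun i f hf =>
    primrecRel_mem.comp (Primrec.list_cons.comp (Primrec.const _) Primrec.snd)
      (hf.comp Primrec.fst)
  have all : ∀ {r : ℕ → ℕ → Prop}, PrimrecRel r →
      PrimrecRel fun (d : ModelData) (l : List ℕ) => ∀ x ∈ l, r x d.1.1 := fun hr =>
    hr.forall_mem_list.comp Primrec.snd
      (Primrec.fst.comp (Primrec.fst.comp Primrec.fst))
  match R with
  | Sum.inl (Sum.inl R) =>
    exact PrimrecPred.and (all Primrec.nat_lt)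
      (cons_mem _ _ (Primrec.fst.comp Primrec.snd))
  | Sum.inl (Sum.inr _) =>
    exact all (r := fun x n => n ≤ x) (Primrec.nat_le.comp Primrec.snd Primrec.fst)
  | Sum.inr i => exact cons_mem _ _ (Primrec.snd.comp Primrec.snd)

/-- The enumeration of the disjoint union that lists the elements of the first summand first. -/
def sumEnum {A : Type a} {S : Type b} {n m : ℕ} (e : Fin n ≃ A) (s : Fin m ≃ S) :
    A ⊕ S ≃ Fin (n + m) :=
  (Equiv.sumCongr e.symm s.symm).trans finSumFinEquiv

@[simp]
theorem sumEnum_inl {A : Type a} {S : Type b} {n m : ℕ} (e : Fin n ≃ A) (s : Fin m ≃ S) (x : A) :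
    (sumEnum e s (Sum.inl x) : ℕ) = e.symm x := by
  simp [sumEnum]

@[simp]
theorem sumEnum_inr {A : Type a} {S : Type b} {n m : ℕ} (e : Fin n ≃ A) (s : Fin m ≃ S) (x : S) :
    (sumEnum e s (Sum.inr x) : ℕ) = n + s.symm x := by
  simp [sumEnum]

/-- With the old elements numbered before the new ones, `Y` becomes the condition of being at least
`n`, and every atomic formula is decided by `atomCheck`. One `P` serves all models, since a model
enters only through its data. -/
theorem exists_primrecRel_realize_plus [L.IsRelational]
    (φ : ((L.sum markLang).sum (relVarLang ar)).Sentence) :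
    ∃ P : ModelData → Prop, PrimrecPred P ∧
      ∀ (d : ModelData) (A : Type c) (S : Type) [L.Structure A]
        (X : (relVarLang ar).Structure (A ⊕ S)) (e : Fin d.1.1 ≃ A) (s : Fin d.1.2 ≃ S),
        (∀ (r : Σ k, L.Relations k) (t : Fin r.1 → Fin d.1.1),
          (ord.symm r : ℕ) :: List.ofFn (fun j => (t j : ℕ)) ∈ d.2.1 ↔
            Structure.RelMap r.2 (e ∘ t)) →
        (∀ i (t : Fin (ar i) → Fin (d.1.1 + d.1.2)),
          (i : ℕ) :: List.ofFn (fun j => (t j : ℕ)) ∈ d.2.2 ↔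
            X.RelMap (⟨i, rfl⟩ : (relVarLang ar).Relations (ar i)) ((sumEnum e s).symm ∘ t)) →
        (@FirstOrder.Language.Sentence.Realize _ (A ⊕ S)
          (@FirstOrder.Language.sumStructure _ _ (A ⊕ S) (plusStructure L A S) X) φ ↔ P d) := by
  obtain ⟨P, hP, h⟩ := exists_primrecRel_realize.{_, _, c} (N := fun d : ModelData => d.1.1 + d.1.2)
    (Primrec.nat_add.comp (Primrec.fst.comp Primrec.fst) (Primrec.snd.comp Primrec.fst))
    (atomCheck ord ar) (primrecRel_atomCheck ord ar) φ
  refine ⟨fun d => P d [], hP.comp Primrec.id (Primrec.const _), ?_⟩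
  intro d A S _ X e s hW hX
  let _ : ((L.sum markLang).sum (relVarLang ar)).Structure (A ⊕ S) :=
    @FirstOrder.Language.sumStructure _ _ (A ⊕ S) (plusStructure L A S) X
  have := h d (A ⊕ S) (sumEnum e s) ?_ default
  · rw [List.ofFn_zero] at this
    exact this
  · intro k R t
    match R with
    | Sum.inl (Sum.inl R) =>
      change (∃ y, t = Sum.inl ∘ y ∧ Structure.RelMap R y) ↔ (∀ x ∈ _, x < d.1.1) ∧ _ ∈ d.2.1
      rw [List.forall_mem_ofFn_iff]
      constructor
      · rintro ⟨y, rfl, hy⟩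
        have hy' := (hW ⟨k, R⟩ (e.symm ∘ y)).2 (by
          simpa only [Function.comp_def, Equiv.apply_symm_apply] using hy)
        simp only [Function.comp_apply, sumEnum_inl] at hy' ⊢
        exact ⟨fun i => (e.symm (y i)).2, hy'⟩
      · rintro ⟨hlt, hmem⟩
        have hy : ∀ i, ∃ y, t i = Sum.inl y := by
          intro i
          have hi := hlt i
          rcases hti : t i with y | y
          · exact ⟨y, rfl⟩
          · rw [hti, sumEnum_inr] at hi
            omega
        choose y hy using hy
        refine ⟨y, funext hy, ?_⟩
        simp only [hy, sumEnum_inl] at hmem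
        simpa only [Function.comp_def, Equiv.apply_symm_apply] using
          (hW ⟨k, R⟩ (e.symm ∘ y)).1 hmem
    | Sum.inl (Sum.inr R) =>
      change (∀ i, ∃ x : S, t i = Sum.inr x) ↔ ∀ x ∈ _, d.1.1 ≤ x
      rw [List.forall_mem_ofFn_iff]
      refine forall_congr' fun i => ?_
      rcases t i with y | y <;> simp
    | Sum.inr ⟨i, hi⟩ =>
      subst hi
      have := hX i (sumEnum e s ∘ t)
      simp only [Function.comp_def, Equiv.symm_apply_apply] at this
      exact this.symm

end ModelData

/-- The model with domain `{0, …, n-1}` whose relations have the tuples in the list `W`. -/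
@[reducible]
def listStructure {L : FirstOrder.Language.{a, b}} [L.IsRelational] {p : ℕ}
    (ord : Fin p ≃ Σ k, L.Relations k) (n : ℕ) (W : List (List ℕ)) :
    L.Structure (ULift.{c} (Fin n)) where
  funMap := fun f _ => isEmptyElim f
  RelMap := fun {k} R x => (ord.symm ⟨k, R⟩ : ℕ) :: List.ofFn (fun j => ((x j).down : ℕ)) ∈ W

/-- A class that is definable in `L_RE` has a semi-decision algorithm. -/
theorem exists_semiDecides_of_definable (L : FirstOrder.Language.{a, b}) [L.IsRelational] (p : ℕ)
    (ord : Fin p ≃ Σ k, L.Relations k) (C : Set (FinModel.{c} L)) (hC : Definable C) :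
    ∃ M : TuringMachine, M.SemiDecides ord C := by
  obtain ⟨φ, hφ⟩ := hC
  obtain ⟨P, hP, hPφ⟩ := exists_primrecRel_realize_plus.{a, b, c} ord φ.body.arity φ.body.body
  -- The two positivity conditions express that the model and the set of new elements are nonempty.
  have hQ : PrimrecRel fun (x : List Bool) (d : ModelData) =>
      (0 < d.1.1 ∧ 0 < d.1.2) ∧ x = listEnc (fun i => (ord i).1) d.1.1 d.2.1 ∧ P d := by
    have hn : Primrec fun q : List Bool × ModelData => q.2.1.1 :=
      Primrec.fst.comp (Primrec.fst.comp Primrec.snd)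
    refine PrimrecPred.and (PrimrecPred.and (Primrec.nat_lt.comp (Primrec.const 0) hn)
      (Primrec.nat_lt.comp (Primrec.const 0) (Primrec.snd.comp (Primrec.fst.comp Primrec.snd))))
      (PrimrecPred.and (Primrec.eq.comp Primrec.fst ?_) (hP.comp Primrec.snd))
    exact (primrec_listEnc _).comp hn (Primrec.fst.comp (Primrec.snd.comp Primrec.snd))
  obtain ⟨M, hM⟩ := exists_turingMachine_of_primrecRel hQ
  refine ⟨M, fun x => (hM x).trans ?_⟩
  constructor
  -- Arbitrary lists `W` and `V` describe some model on `{0, …, n-1}` and some relation variables,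
  -- so data found by the search always stem from a model.
  · rintro ⟨⟨⟨n, m⟩, W, V⟩, ⟨hn, hm⟩, hx, hd⟩
    dsimp only at hn hm hx
    let _ := listStructure.{a, b, c} ord n W
    have : Nonempty (ULift.{c} (Fin n)) := ⟨⟨⟨0, hn⟩⟩⟩
    have : Nonempty (Fin m) := ⟨⟨0, hm⟩⟩
    let e : Fin n ≃ ULift.{c} (Fin n) := Equiv.ulift.symm
    have hW : ∀ (r : Σ k, L.Relations k) (t : Fin r.1 → Fin n),
        (ord.symm r : ℕ) :: List.ofFn (fun j => (t j : ℕ)) ∈ W ↔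
          Structure.RelMap r.2 (e ∘ t) := fun r t => Iff.rfl
    let X : (relVarLang φ.body.arity).Structure (ULift.{c} (Fin n) ⊕ Fin m) :=
      { funMap := fun f _ => isEmptyElim f
        RelMap := fun i x =>
          (i.1 : ℕ) :: List.ofFn (fun j => (sumEnum e (Equiv.refl _) (x j) : ℕ)) ∈ V }
    refine ⟨⟨ULift.{c} (Fin n)⟩, (hφ _).2 ?_, n, e, ?_⟩
    · refine ⟨Fin m, inferInstance, inferInstance, X, ?_⟩
      refine (hPφ ((n, m), W, V) _ _ X e (Equiv.refl _) hW fun i t => ?_).2 hd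
      simp [X, Structure.RelMap]
    · rw [hx, enc_eq_listEnc ord e W hW]
  · rintro ⟨A, hA, n, e, rfl⟩
    obtain ⟨S, hS, hS', X, hX⟩ := (hφ A).1 hA
    obtain ⟨m, ⟨s⟩⟩ := Finite.exists_equiv_fin S
    have hidx : Function.Injective fun r : Σ k, L.Relations k => (ord.symm r : ℕ) :=
      Fin.val_injective.comp ord.symm.injective
    have : Finite (Σ k, L.Relations k) := Finite.of_equiv _ ord
    obtain ⟨W, hW⟩ := exists_list_mem_iff hidx
      fun (r : Σ k, L.Relations k) (t : Fin r.1 → Fin n) => Structure.RelMap r.2 (e ∘ t)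
    obtain ⟨V, hV⟩ := exists_list_mem_iff (n := n + m) (k := φ.body.arity) Fin.val_injective
      fun i t => X.RelMap (⟨i, rfl⟩ : (relVarLang φ.body.arity).Relations (φ.body.arity i))
        ((sumEnum e s.symm).symm ∘ t)
    refine ⟨((n, m), W, V), ⟨?_, ?_⟩, enc_eq_listEnc ord e W hW,
      (hPφ ((n, m), W, V) _ _ X e s.symm hW hV).1 hX⟩
    · exact Fin.pos_iff_nonempty.2 (e.symm.nonempty_congr.1 inferInstance)
    · exact Fin.pos_iff_nonempty.2 (s.nonempty_congr.1 inferInstance)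

end LRE

namespace LRE

open Turing

/-! ### Runs with absolute head positions -/

namespace TuringMachine

variable (M : TuringMachine)

/-- Configurations with an absolute head position on a tape indexed by the integers. -/
structure AbsConfig where
  state : M.State
  head : ℤ
  cell : ℤ → M.Symbol

variable {M}

/-- The displacement of the head caused by a move. -/
def shift : Option Dir → ℤ
  | none => 0
  | some .left => -1
  | some .right => 1

/-- One step of a run on configurations with an absolute head position. -/
def AbsStep (c c' : M.AbsConfig) : Prop :=
  ∃ b d, (c'.state, b, d) ∈ M.trans c.state (c.cell c.head) ∧
    c'.cell = Function.update c.cell c.head b ∧ c'.head = c.head + shift d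

variable (M) in
/-- The content of the cells of the initial tape. -/
def inputCell (x : List Bool) (i : ℤ) : M.Symbol :=
  (Tape.mk₁ (x.map M.input)).nth i

theorem inputCell_of_lt {x : List Bool} {j : ℕ} (h : j < x.length) :
    M.inputCell x j = M.input x[j] := by
  rw [inputCell, Tape.mk₁, Tape.mk₂, Tape.mk'_nth_nat, ListBlank.nth_mk,
    List.getI_eq_getElem _ (by simpa using h), List.getElem_map]

theorem inputCell_of_notMem {x : List Bool} {i : ℤ} (h : ∀ j : ℕ, j < x.length → i ≠ j) :
    M.inputCell x i = default := by
  rcases i with j | j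
  · have hj : x.length ≤ j := by
      by_contra hlt
      exact h j (by omega) rfl
    change (Tape.mk₁ (x.map M.input)).nth (j : ℤ) = _
    rw [Tape.mk₁, Tape.mk₂, Tape.mk'_nth_nat, ListBlank.nth_mk,
      List.getI_eq_default _ (by simpa using hj)]
  · change (ListBlank.mk []).nth j = _
    rw [ListBlank.nth_mk, List.getI_nil]

variable (M) in
/-- The initial configuration on input `x`. -/
def absInit (x : List Bool) : M.AbsConfig where
  state := M.start
  head := 0
  cell := M.inputCell x

/-- `c` and `z` describe the same configuration. -/
def Represents (c : M.Config) (z : M.AbsConfig) : Prop :=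
  c.state = z.state ∧ ∀ i, c.tape.nth i = z.cell (z.head + i)

/-- Cell `i` counted from the head is cell `h + i` of the fixed tape; writing affects only the cell
under the head, and a move changes only the offset. -/
theorem move_write_nth {T : Tape M.Symbol} {f : ℤ → M.Symbol} {h : ℤ}
    (hT : ∀ i, T.nth i = f (h + i)) (b : M.Symbol) (d : Option Dir) (i : ℤ) :
    (match d with
      | none => T.write b
      | some d => (T.write b).move d).nth i = Function.update f h b (h + shift d + i) := by
  rcases d with _ | _ | _
  · simp [shift, Tape.write_nth, Function.update_apply, hT]
  · simp only [shift, Tape.move_left_nth, Tape.write_nth, Function.update_apply, hT]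
    exact if_congr (by omega) rfl (by congr 1; ring)
  · simp only [shift, Tape.move_right_nth, Tape.write_nth, Function.update_apply, hT]
    exact if_congr (by omega) rfl (by congr 1; ring)

theorem Represents.head_eq {c : M.Config} {z : M.AbsConfig} (h : Represents c z) :
    c.tape.head = z.cell z.head := by
  simpa using h.2 0

/-- Tapes are indexed relative to the head, whereas in a space-time diagram a cell has to keep its
name while the head moves. The correspondence `Represents` is preserved by steps in both directions.
-/
theorem accepts_iff (x : List Bool) : M.Accepts x ↔
    ∃ z, Relation.ReflTransGen AbsStep (M.absInit x) z ∧ z.state ∈ M.accept := by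
  have hinit : Represents (M.init x) (M.absInit x) := ⟨rfl, fun i => by
    rw [absInit, zero_add]
    rfl⟩
  constructor
  · rintro ⟨c, hc, hacc⟩
    suffices ∃ z, Relation.ReflTransGen AbsStep (M.absInit x) z ∧ Represents c z by
      obtain ⟨z, hz, hcz⟩ := this
      exact ⟨z, hz, hcz.1 ▸ hacc⟩
    clear hacc
    induction hc with
    | refl => exact ⟨_, .refl, hinit⟩
    | @tail c c' _ hstep ih =>
      obtain ⟨z, hz, hcz⟩ := ih
      obtain ⟨b, d, htr, htape⟩ := hstep
      rw [hcz.head_eq, hcz.1] at htr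
      refine ⟨⟨c'.state, z.head + shift d, Function.update z.cell z.head b⟩,
        hz.tail ⟨b, d, htr, rfl, rfl⟩, rfl, fun i => ?_⟩
      rw [htape]
      exact move_write_nth hcz.2 b d i
  · rintro ⟨z, hz, hacc⟩
    suffices ∃ c, Relation.ReflTransGen M.Step (M.init x) c ∧ Represents c z by
      obtain ⟨c, hc, hcz⟩ := this
      exact ⟨c, hc, hcz.1 ▸ hacc⟩
    clear hacc
    induction hz with
    | refl => exact ⟨_, .refl, hinit⟩
    | @tail z z' _ hstep ih =>
      obtain ⟨c, hc, hcz⟩ := ih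
      obtain ⟨b, d, htr, hcell, hhead⟩ := hstep
      rw [← hcz.head_eq, ← hcz.1] at htr
      refine ⟨⟨z'.state, _⟩, hc.tail ⟨b, d, htr, rfl⟩, rfl, fun i => ?_⟩
      rw [hcell, hhead]
      exact move_write_nth hcz.2 b d i

/-- A reachable configuration is the last one of a finite sequence of steps, along which the
distance of the head from its initial position is bounded by the number of steps. -/
theorem exists_run {x : List Bool} {z : M.AbsConfig}
    (h : Relation.ReflTransGen AbsStep (M.absInit x) z) :
    ∃ (T : ℕ) (s : ℕ → M.AbsConfig), s 0 = M.absInit x ∧ s T = z ∧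
      (∀ t < T, AbsStep (s t) (s (t + 1))) ∧ ∀ t ≤ T, |(s t).head| ≤ t := by
  induction h with
  | refl => exact ⟨0, fun _ => M.absInit x, rfl, rfl, by simp, by simp [absInit]⟩
  | @tail z z' _ hstep ih =>
    obtain ⟨T, s, h₀, hT, hs, hh⟩ := ih
    refine ⟨T + 1, fun t => if t ≤ T then s t else z', by simp [h₀], by simp, ?_, ?_⟩
    · intro t ht
      rcases Nat.lt_succ_iff_lt_or_eq.1 ht with h | rfl
      · simpa [h.le, h] using hs t h
      · simpa [hT] using hstep
    · intro t ht
      rcases Nat.le_succ_iff.1 ht with h | rfl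
      · simpa [h] using hh t h
      · have := hh T le_rfl
        obtain ⟨b, d, -, -, hd⟩ := hstep
        rw [hT] at this
        simp only [Nat.succ_eq_add_one, add_le_iff_nonpos_right, nonpos_iff_eq_zero, one_ne_zero,
          if_false, hd]
        have hsh : |shift d| ≤ 1 := by rcases d with _ | _ | _ <;> simp [shift]
        push_cast
        exact (abs_add_le _ _).trans (add_le_add this hsh)

end TuringMachine

/-! ### Encodings as lists of bits indexed by tuples -/

/-- The lexicographic order on tuples, with respect to the relation `r` on the entries. -/
def TupleLt {D : Type*} (r : D → D → Prop) {k : ℕ} (u v : Fin k → D) : Prop :=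
  ∃ j, (∀ i, i < j → u i = v i) ∧ r (u j) (v j)

theorem TupleLt.asymm {D : Type*} {r : D → D → Prop} (hr : ∀ x y, r x y → ¬ r y x) {k : ℕ}
    {u v : Fin k → D} (h : TupleLt r u v) : ¬ TupleLt r v u := by
  rintro ⟨j', h', hr'⟩
  obtain ⟨j, h, hj⟩ := h
  rcases lt_trichotomy j j' with hlt | rfl | hlt
  · rw [h' j hlt] at hj
    exact hr _ _ hj hj
  · exact hr _ _ hj hr'
  · rw [h j' hlt] at hr'
    exact hr _ _ hr' hr'

theorem mem_lexTuples {n k : ℕ} (u : Fin k → Fin n) : u ∈ lexTuples n k := by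
  induction k with
  | zero => simpa [lexTuples] using Subsingleton.elim _ _
  | succ k ih =>
    rw [lexTuples, List.mem_flatMap]
    exact ⟨u 0, List.mem_finRange _, List.mem_map.2 ⟨Fin.tail u, ih _, Fin.cons_self_tail u⟩⟩

theorem pairwise_lexTuples (n k : ℕ) : (lexTuples n k).Pairwise (TupleLt (· < ·)) := by
  induction k with
  | zero => simp [lexTuples]
  | succ k ih =>
    rw [lexTuples, List.pairwise_flatMap]
    constructor
    · intro a _
      rw [List.pairwise_map]
      refine ih.imp ?_
      rintro u v ⟨j, h, hj⟩
      refine ⟨j.succ, fun i hi => ?_, by simpa using hj⟩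
      refine Fin.cases (fun _ => rfl) (fun i hi => ?_) i hi
      simpa using h i (Fin.succ_lt_succ_iff.1 hi)
    · refine (List.pairwise_lt_finRange n).imp ?_
      intro a b hab u hu v hv
      obtain ⟨u, -, rfl⟩ := List.mem_map.1 hu
      obtain ⟨v, -, rfl⟩ := List.mem_map.1 hv
      exact ⟨0, fun i hi => absurd hi (Fin.not_lt_zero i), by simpa using hab⟩

/-- All tuples over `{0, …, n-1}` of length `K i` for some `i`, ordered by `i` and then
lexicographically. -/
def blockTuples (n : ℕ) {q : ℕ} (K : Fin q → ℕ) : List (Σ i, Fin (K i) → Fin n) :=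
  (List.finRange q).flatMap fun i => (lexTuples n (K i)).map (Sigma.mk i)

/-- The order of `blockTuples`. -/
abbrev BlockLt {n q : ℕ} (K : Fin q → ℕ) : (Σ i, Fin (K i) → Fin n) → (Σ i, Fin (K i) → Fin n) → Prop :=
  Sigma.Lex (· < ·) fun _ => TupleLt (· < ·)

theorem mem_blockTuples {n q : ℕ} (K : Fin q → ℕ) (w : Σ i, Fin (K i) → Fin n) :
    w ∈ blockTuples n K :=
  List.mem_flatMap.2 ⟨w.1, List.mem_finRange _, List.mem_map.2 ⟨w.2, mem_lexTuples _, rfl⟩⟩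

theorem pairwise_blockTuples (n : ℕ) {q : ℕ} (K : Fin q → ℕ) :
    (blockTuples n K).Pairwise (BlockLt K) := by
  rw [blockTuples, List.pairwise_flatMap]
  constructor
  · intro i _
    rw [List.pairwise_map]
    exact (pairwise_lexTuples n (K i)).imp fun h => Sigma.Lex.right _ _ h
  · refine (List.pairwise_lt_finRange q).imp ?_
    intro i j hij u hu v hv
    obtain ⟨u, -, rfl⟩ := List.mem_map.1 hu
    obtain ⟨v, -, rfl⟩ := List.mem_map.1 hv
    exact Sigma.Lex.left _ _ hij

theorem BlockLt.asymm {n q : ℕ} {K : Fin q → ℕ} {v w : Σ i, Fin (K i) → Fin n}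
    (h : BlockLt K v w) : ¬ BlockLt K w v := by
  intro h'
  cases h with
  | left u v hij =>
    cases h' with
    | left _ _ hji => exact lt_asymm hij hji
    | right _ _ _ => exact lt_irrefl _ hij
  | right u v huv =>
    cases h' with
    | left _ _ hji => exact lt_irrefl _ hji
    | right _ _ hvu => exact huv.asymm (fun _ _ => lt_asymm) hvu

theorem lt_of_blockLt_getElem {n q : ℕ} {K : Fin q → ℕ} {i j : ℕ}
    (hi : i < (blockTuples n K).length) (hj : j < (blockTuples n K).length)
    (h : BlockLt K (blockTuples n K)[i] (blockTuples n K)[j]) : i < j := by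
  rcases lt_trichotomy i j with hlt | rfl | hlt
  · exact hlt
  · exact absurd h h.asymm
  · exact absurd (List.pairwise_iff_getElem.1 (pairwise_blockTuples n K) j i hj hi hlt) h.asymm

theorem nodup_blockTuples (n : ℕ) {q : ℕ} (K : Fin q → ℕ) : (blockTuples n K).Nodup :=
  (pairwise_blockTuples n K).imp fun h he => by
    subst he
    exact h.asymm h

/-- A strictly increasing map of a finite chain into the integers `≥ c` whose range is downward
closed sends the `j`-th element to `c + j`. -/
theorem position_eq {Ω : Type*} {r : Ω → Ω → Prop} {l : List Ω} (hl : l.Pairwise r)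
    (hmem : ∀ w, w ∈ l) {f : Ω → ℤ} {c : ℤ} (hf : ∀ v w, r v w → f v < f w) (hc : ∀ w, c ≤ f w)
    (hdown : ∀ w y, c ≤ y → y < f w → ∃ v, f v = y) (j : ℕ) (hj : j < l.length) :
    f l[j] = c + j := by
  rw [List.pairwise_iff_getElem] at hl
  induction j using Nat.strong_induction_on with
  | _ j ih =>
    have h₁ : c + j ≤ f l[j] := by
      rcases j with _ | j
      · simpa using hc _
      · have := hf _ _ (hl j (j + 1) (by omega) hj (by omega))
        rw [ih j (by omega)] at this
        push_cast
        omega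
    -- If the `j`-th value exceeded `c + j`, then `c + j` would be the value of some element; but
    -- earlier elements have smaller values, and the others larger ones.
    refine le_antisymm (le_of_not_gt fun hlt => ?_) h₁
    obtain ⟨v, hv⟩ := hdown l[j] (c + j) (by omega) hlt
    obtain ⟨j', hj', rfl⟩ := List.getElem_of_mem (hmem v)
    rcases lt_trichotomy j' j with h | rfl | h
    · rw [ih j' h] at hv
      omega
    · omega
    · have := hf _ _ (hl j j' hj hj' h)
      omega

end LRE

namespace LRE

open FirstOrder FirstOrder.Language

universe a b c

/-! ### Encodings as uniform lists of blocks -/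

section Blocks

variable {L : FirstOrder.Language.{a, b}} {p : ℕ} (ord : Fin p ≃ Σ k, L.Relations k)

/-- The arities of the blocks of an encoding: the block of zeros is indexed by the elements, the
separating one by the empty tuple, and the further blocks by the tuples of the relations. -/
def blockArity : Fin (p + 2) → ℕ :=
  Fin.cons 1 (Fin.cons 0 fun i => (ord i).1)

/-- The bits in the blocks of an encoding. -/
def BlockBit {A : Type c} [L.Structure A] : ∀ i, (Fin (blockArity ord i) → A) → Prop :=
  Fin.cases (fun _ => False) (Fin.cases (fun _ => True)
    fun i (u : Fin (ord i).1 → A) => Structure.RelMap (ord i).2 u)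

theorem not_blockBit_zero {A : Type c} [L.Structure A] (u : Fin (blockArity ord 0) → A) :
    ¬ BlockBit ord 0 u :=
  id

theorem blockBit_one {A : Type c} [L.Structure A] (u : Fin (blockArity ord (Fin.succ 0)) → A) :
    BlockBit ord (Fin.succ 0) u :=
  trivial

open Classical in
-- The prefix `0ⁿ` is a block of arity `1` with all bits false, and the separator a block of arity
-- `0` with a true bit. This makes the place of every bit its rank in a single linear order, with no
-- case distinction or arithmetic on lengths.
theorem enc_eq_map_blockTuples {A : Type c} [L.Structure A] {n : ℕ} (e : Fin n ≃ A) :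
    enc ord e = (blockTuples n (blockArity ord)).map
      fun w => decide (BlockBit ord w.1 (e ∘ w.2)) := by
  have h₁ : ((lexTuples n 1).map fun _ => false) = List.replicate n false := by
    rw [List.map_const']
    simp [lexTuples]
  rw [blockTuples, List.map_flatMap, List.finRange_succ, List.finRange_succ, List.map_cons,
    List.flatMap_cons, List.flatMap_cons, List.flatMap_map, List.flatMap_map, enc, ← h₁,
    List.append_assoc]
  congr 1
  · rw [List.map_map]
    refine List.map_congr_left fun u _ => ?_
    exact (decide_eq_false (not_blockBit_zero ord _)).symm
  · congr 1
    · exact congrArg (fun b => [b]) (decide_eq_true (blockBit_one ord _)).symm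
    · refine List.flatMap_congr fun i _ => ?_
      rw [encRel, List.map_map]
      rfl

/-- The first `1` of the word reveals the size of the domain; after that, equal bits at equal tuples
say that matching the two enumerations preserves all relations. -/
theorem nonempty_equiv_of_enc_eq [L.IsRelational] {A B : Type c} [L.Structure A] [L.Structure B]
    {n m : ℕ} (e : Fin n ≃ A) (f : Fin m ≃ B) (h : enc ord e = enc ord f) :
    Nonempty (A ≃[L] B) := by
  have hnm : n = m := by
    have h' := congrArg (List.idxOf true) h
    have key : ∀ (k : ℕ) (l : List Bool),
        List.idxOf true (List.replicate k false ++ [true] ++ l) = k := by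
      intro k l
      rw [List.append_assoc, List.idxOf_append_of_notMem (by simp)]
      simp
    rwa [enc, enc, key, key] at h'
  subst hnm
  rw [enc_eq_map_blockTuples, enc_eq_map_blockTuples, List.map_inj_left] at h
  refine ⟨⟨e.symm.trans f, fun g _ => isEmptyElim g, fun {k} R x => ?_⟩⟩
  obtain ⟨i, hi⟩ := ord.surjective ⟨k, R⟩
  have key : ∀ (r : Σ k, L.Relations k), ord i = r → ∀ t : Fin r.1 → Fin n,
      Structure.RelMap r.2 (e ∘ t) ↔ Structure.RelMap r.2 (f ∘ t) := by
    rintro r rfl t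
    exact decide_eq_decide.1 (h ⟨i.succ.succ, t⟩ (mem_blockTuples _ _))
  have := key _ hi (e.symm ∘ x)
  simp only [Function.comp_def, Equiv.apply_symm_apply] at this
  exact this.symm

end Blocks

end LRE

namespace LRE

open TuringMachine

/-! ### Space-time diagrams of accepting runs -/

section Diagram

variable (M : TuringMachine) {q : ℕ} (K : Fin q → ℕ) {D : Type*}

/-- At time `t`, the cell `r` holds the symbol `s`, and the head is at `r` in state `o` if `r = h`
and elsewhere otherwise. -/
def SymbolAt (cell : M.Symbol × Option M.State → D → D → Prop) (o : M.State) (s : M.Symbol)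
    (h t r : D) : Prop :=
  (r = h → cell (s, some o) t r) ∧ (¬ r = h → cell (s, none) t r)

/-- `y` is the immediate successor of `x`. -/
def IsNext (lt : D → D → Prop) (x y : D) : Prop :=
  lt x y ∧ ∀ z, ¬ (lt x z ∧ lt z y)

/-- A move of the head takes it from `x` to `y`. -/
def IsMove (lt : D → D → Prop) (x y : D) : Option Turing.Dir → Prop
  | none => x = y
  | some .left => IsNext lt y x
  | some .right => IsNext lt x y

/-- Possible transitions of a machine: a state and a symbol with their successors and a move. -/
abbrev Transition : Type :=
  {τ : (M.State × M.Symbol) × M.State × M.Symbol × Option Turing.Dir // τ.2 ∈ M.trans τ.1.1 τ.1.2}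

/-- The configuration at time `t` is a successor of the one at time `t'`. -/
def DiagramStep (lt : D → D → Prop) (cell : M.Symbol × Option M.State → D → D → Prop)
    (t' t : D) : Prop :=
  ∃ x y, ∃ τ : Transition M, IsMove lt x y τ.1.2.2.2 ∧ cell (τ.1.1.2, some τ.1.1.1) t' x ∧
    SymbolAt M cell τ.1.2.1 τ.1.2.2.1 y t x ∧
    ∀ r, ¬ r = x → ∀ κ : M.Symbol × Option M.State,
      cell κ t' r → SymbolAt M cell τ.1.2.1 κ.1 y t r

/-- The configuration at time `t` is the initial one, where `c` is the initial head position. -/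
def DiagramInit (bit : ∀ i, (Fin (K i) → D) → Prop)
    (cell : M.Symbol × Option M.State → D → D → Prop) (pos : ∀ i, (Fin (K i) → D) → D → Prop)
    (c t : D) : Prop :=
  ∀ r, (∀ i u, pos i u r → (bit i u → SymbolAt M cell M.start (M.input true) c t r) ∧
      (¬ bit i u → SymbolAt M cell M.start (M.input false) c t r)) ∧
    ((∀ i u, ¬ pos i u r) → SymbolAt M cell M.start default c t r)

/-- The relations `lt`, `cell` and `pos` describe an accepting run: `lt` is a linear order, times
and tape positions are elements of the domain, `cell` describes the tape and the head, and `pos`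
places the bits of the input on the tape. -/
structure IsDiagram (fresh : D → Prop) (bit : ∀ i, (Fin (K i) → D) → Prop) (lt : D → D → Prop)
    (cell : M.Symbol × Option M.State → D → D → Prop)
    (pos : ∀ i, (Fin (K i) → D) → D → Prop) : Prop where
  irrefl : ∀ x, ¬ lt x x
  trans : ∀ x y z, lt x y → lt y z → lt x z
  total : ∀ x y, lt x y ∨ x = y ∨ lt y x
  cell_unique : ∀ t r κ κ', ¬ κ = κ' → cell κ t r → ¬ cell κ' t r
  pos_exists : ∀ i u, (∀ j, ¬ fresh (u j)) → ∃ x, pos i u x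
  pos_old : ∀ i u x, pos i u x → ∀ j, ¬ fresh (u j)
  pos_unique : ∀ i u x y, pos i u x → pos i u y → x = y
  pos_lex : ∀ i u v x y, TupleLt lt u v → pos i u x → pos i v y → lt x y
  pos_block : ∀ i j, i < j → ∀ u v x y, pos i u x → pos j v y → lt x y
  run : ∃ c, (∀ i u x, pos i u x → ¬ lt x c) ∧
    (∀ y, ¬ lt y c → (∃ i u, pos i u y) ∨ ∀ i u x, pos i u x → lt x y) ∧
    ∀ t, DiagramInit M K bit cell pos c t ∨ ∃ t', lt t' t ∧ DiagramStep M lt cell t' t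
  accepting : ∃ t r, ∃ κ : M.Symbol × M.accept, cell (κ.1, some κ.2) t r

theorem exists_rank [Finite D] {lt : D → D → Prop} (irrefl : ∀ x, ¬ lt x x)
    (trans : ∀ x y z, lt x y → lt y z → lt x z) (total : ∀ x y, lt x y ∨ x = y ∨ lt y x) :
    ∃ (N : ℕ) (g : D ≃ Fin N), ∀ x y, lt x y ↔ g x < g y := by
  classical
  have : IsStrictTotalOrder D lt :=
    { irrefl := irrefl
      trans := trans
      trichotomous := fun x y h h' => ((total x y).resolve_left h).resolve_right h' }
  let _ := linearOrderOfSTO lt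
  let _ := Fintype.ofFinite D
  let g := monoEquivOfFin D rfl
  exact ⟨_, g.symm.toEquiv, fun x y => (g.symm.lt_iff_lt (x := x) (y := y)).symm⟩

variable {M K}

/-- The content of the initial tape in terms of the positions of the bits. -/
theorem inputCell_of_bit {n : ℕ} {b : (Σ i, Fin (K i) → Fin n) → Bool} {j : ℕ}
    (hj : j < (blockTuples n K).length) :
    M.inputCell ((blockTuples n K).map b) j = M.input (b (blockTuples n K)[j]) := by
  rw [inputCell_of_lt (by simpa using hj), List.getElem_map]

/-- `lt` is the order and `z` the numbering of the positions, with `0` for the origin `c`. -/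
structure IsCoordinate (lt : D → D → Prop) (c : D) (z : D → ℤ) : Prop where
  injective : Function.Injective z
  lt_iff : ∀ x y, lt x y ↔ z x < z y
  origin : z c = 0
  interval : ∀ x y k, z x ≤ k → k ≤ z y → ∃ w, z w = k

theorem isCoordinate_of_equiv {N : ℕ} (g : D ≃ Fin N) (c : D) :
    IsCoordinate (fun x y => g x < g y) c fun x => (g x : ℤ) - g c := by
  refine ⟨fun x y h => g.injective (Fin.ext ?_), fun x y => ?_, sub_self _, fun x y k h₁ h₂ => ?_⟩
  · have : (g x : ℤ) - g c = g y - g c := h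
    omega
  · rw [Fin.lt_def]
    omega
  · have h₃ := (g x).2
    have h₄ := (g y).2
    refine ⟨g.symm ⟨(k + g c).toNat, by omega⟩, ?_⟩
    simp only [Equiv.apply_symm_apply]
    omega

theorem exists_isCoordinate [Finite D] {lt : D → D → Prop} (irrefl : ∀ x, ¬ lt x x)
    (trans : ∀ x y z, lt x y → lt y z → lt x z) (total : ∀ x y, lt x y ∨ x = y ∨ lt y x) (c : D) :
    ∃ z, IsCoordinate lt c z := by
  obtain ⟨N, g, hg⟩ := exists_rank irrefl trans total
  obtain rfl : lt = fun x y => g x < g y := funext₂ fun x y => propext (hg x y)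
  exact ⟨_, isCoordinate_of_equiv g c⟩

theorem IsCoordinate.isNext_iff {lt : D → D → Prop} {c : D} {z : D → ℤ}
    (hz : IsCoordinate lt c z) (x y : D) : IsNext lt x y ↔ z y = z x + 1 := by
  simp only [IsNext, hz.lt_iff]
  constructor
  · rintro ⟨h, h'⟩
    by_contra hne
    obtain ⟨w, hw⟩ := hz.interval x y (z x + 1) (by omega) (by omega)
    exact h' w (by omega)
  · intro h
    exact ⟨by omega, fun w => by omega⟩

theorem IsCoordinate.isMove_iff {lt : D → D → Prop} {c : D} {z : D → ℤ}
    (hz : IsCoordinate lt c z) (x y : D) (d : Option Turing.Dir) :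
    IsMove lt x y d ↔ z y = z x + shift d := by
  rcases d with _ | _ | _
  · rw [shift, add_zero, hz.injective.eq_iff]
    exact eq_comm
  · rw [IsMove, hz.isNext_iff, shift]
    omega
  · rw [IsMove, hz.isNext_iff, shift]

/-- The positions of the bits, counted from the origin. -/
theorem coordinate_pos {fresh : D → Prop} {bit : ∀ i, (Fin (K i) → D) → Prop}
    {lt : D → D → Prop} {cell : M.Symbol × Option M.State → D → D → Prop}
    {pos : ∀ i, (Fin (K i) → D) → D → Prop} (h : IsDiagram M K fresh bit lt cell pos)
    {c : D} {z : D → ℤ} (hz : IsCoordinate lt c z) (hc : ∀ i u x, pos i u x → ¬ lt x c)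
    (hdown : ∀ y, ¬ lt y c → (∃ i u, pos i u y) ∨ ∀ i u x, pos i u x → lt x y)
    {n : ℕ} {e : Fin n → D} (he : ∀ i j, i < j → lt (e i) (e j))
    (hrange : ∀ x, ¬ fresh x ↔ ∃ i, e i = x) {j : ℕ} (hj : j < (blockTuples n K).length) {x : D}
    (hx : pos (blockTuples n K)[j].1 (e ∘ (blockTuples n K)[j].2) x) : z x = j := by
  have hex : ∀ w : Σ i, Fin (K i) → Fin n, ∃ x, pos w.1 (e ∘ w.2) x := fun w =>
    h.pos_exists _ _ fun j => (hrange _).2 ⟨_, rfl⟩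
  choose f hf using hex
  have hfx : x = f (blockTuples n K)[j] := h.pos_unique _ _ _ _ hx (hf _)
  -- The block and lexicographic axioms give monotonicity, `hc` the lower bound, and `hdown` the
  -- absence of gaps.
  have key := position_eq (pairwise_blockTuples n K) (mem_blockTuples K)
    (f := fun w => z (f w)) (c := 0) ?_ ?_ ?_ j hj
  · rw [hfx, key, zero_add]
  · intro v w hvw
    rw [← hz.lt_iff]
    cases hvw with
    | left u v hij => exact h.pos_block _ _ hij _ _ _ _ (hf ⟨_, u⟩) (hf ⟨_, v⟩)
    | right u v huv =>
      refine h.pos_lex _ _ _ _ _ ?_ (hf ⟨_, u⟩) (hf ⟨_, v⟩)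
      obtain ⟨j, h₁, h₂⟩ := huv
      exact ⟨j, fun i hi => congrArg e (h₁ i hi), he _ _ h₂⟩
  · intro w
    have := hc _ _ _ (hf w)
    rw [hz.lt_iff, hz.origin] at this
    exact not_lt.1 this
  · intro w y hy₀ hy
    obtain ⟨r, hr⟩ := hz.interval c (f w) y (by rw [hz.origin]; exact hy₀) hy.le
    rcases hdown r (by rw [hz.lt_iff, hz.origin]; omega) with ⟨i, u, hu⟩ | hlt
    · choose u' hu' using fun j => (hrange (u j)).1 (h.pos_old _ _ _ hu j)
      obtain rfl : e ∘ u' = u := funext hu'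
      exact ⟨⟨i, u'⟩, by rw [h.pos_unique _ _ _ _ (hf ⟨i, u'⟩) hu, hr]⟩
    · have := hlt _ _ _ (hf w)
      rw [hz.lt_iff] at this
      omega

open Classical in
/-- A space-time diagram yields an accepting run. -/
theorem IsDiagram.accepts [Finite D] {fresh : D → Prop} {bit : ∀ i, (Fin (K i) → D) → Prop}
    {lt : D → D → Prop} {cell : M.Symbol × Option M.State → D → D → Prop}
    {pos : ∀ i, (Fin (K i) → D) → D → Prop} (h : IsDiagram M K fresh bit lt cell pos)
    {n : ℕ} {e : Fin n → D} (he : ∀ i j, i < j → lt (e i) (e j))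
    (hrange : ∀ x, ¬ fresh x ↔ ∃ i, e i = x) :
    M.Accepts ((blockTuples n K).map fun w => decide (bit w.1 (e ∘ w.2))) := by
  set x := (blockTuples n K).map fun w => decide (bit w.1 (e ∘ w.2)) with hx
  obtain ⟨c, hc, hdown, hrun⟩ := h.run
  obtain ⟨z, hz⟩ := exists_isCoordinate h.irrefl h.trans h.total c
  have hpos := fun (j : ℕ) (hj : j < (blockTuples n K).length) (r : D) =>
    coordinate_pos h hz hc hdown he hrange hj (x := r)
  have unique : ∀ {t r κ κ'}, cell κ t r → cell κ' t r → κ = κ' := fun {t r κ κ'} h₁ h₂ => by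
    by_contra hne
    exact h.cell_unique t r κ κ' hne h₁ h₂
  have symbolAt : ∀ {o s y t r}, SymbolAt M cell o s y t r →
      cell (s, if r = y then some o else none) t r := by
    intro o s y t r hs
    split_ifs with hr
    · exact hs.1 hr
    · exact hs.2 hr
  have wf : WellFounded lt := by
    have : IsTrans D lt := ⟨h.trans⟩
    have : Std.Irrefl lt := ⟨h.irrefl⟩
    exact Finite.wellFounded_of_trans_of_irrefl lt
  -- By well-founded induction along `lt`, every time shows a reachable configuration on the part of
  -- the tape covered by the domain. The predecessor may be any earlier time, not only the preceding
  -- one.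
  have rep : ∀ t, ∃ C : M.AbsConfig, Relation.ReflTransGen AbsStep (M.absInit x) C ∧
      ∃ y, z y = C.head ∧ ∀ r, cell (C.cell (z r), if r = y then some C.state else none) t r := by
    intro t
    induction t using wf.induction with
    | _ t ih =>
      rcases hrun t with hinit | ⟨t', hlt, x₀, y, ⟨⟨⟨o, s⟩, o', s', d⟩, hτ⟩, hmove, hx₀, hat, hrest⟩
      · refine ⟨_, .refl, c, hz.origin, fun r => symbolAt ?_⟩
        obtain ⟨hbit, hblank⟩ := hinit r
        by_cases hr : ∃ i u, pos i u r
        · obtain ⟨i, u, hu⟩ := hr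
          choose u' hu' using fun j => (hrange (u j)).1 (h.pos_old _ _ _ hu j)
          obtain rfl : e ∘ u' = u := funext hu'
          obtain ⟨j, hj, hw⟩ := List.getElem_of_mem (mem_blockTuples K ⟨i, u'⟩)
          have hzr := hpos j hj r (by rw [hw]; exact hu)
          have hcell : (M.absInit x).cell (z r) = M.input (decide (bit i (e ∘ u'))) := by
            rw [hzr, hx]
            exact (inputCell_of_bit hj).trans (by rw [hw])
          rw [hcell]
          by_cases hb : bit i (e ∘ u')
          · rw [decide_eq_true hb]
            exact (hbit i _ hu).1 hb
          · rw [decide_eq_false hb]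
            exact (hbit i _ hu).2 hb
        · have hcell : (M.absInit x).cell (z r) = default := by
            refine inputCell_of_notMem fun j hj hzr => hr ?_
            have hj' : j < (blockTuples n K).length := by simpa [hx] using hj
            obtain ⟨w, hw⟩ := h.pos_exists (blockTuples n K)[j].1 (e ∘ (blockTuples n K)[j].2)
              fun j => (hrange _).2 ⟨_, rfl⟩
            obtain rfl : r = w := hz.injective (hzr.trans (hpos j hj' w hw).symm)
            exact ⟨_, _, hw⟩
          rw [hcell]
          exact hblank fun i u hu => hr ⟨i, u, hu⟩
      · obtain ⟨C, hC, y', hy', hcell⟩ := ih t' hlt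
        dsimp only at hτ hmove hx₀ hat hrest
        have hxy := unique hx₀ (hcell x₀)
        obtain ⟨rfl, ho⟩ := Prod.mk.inj hxy
        -- A cell content that includes a state can only be that of the head cell.
        have hx₀y : x₀ = y' := by
          by_contra hne
          rw [if_neg hne] at ho
          cases ho
        subst hx₀y
        rw [if_pos rfl, Option.some.injEq] at ho
        subst ho
        rw [hz.isMove_iff] at hmove
        rw [hy'] at hτ hmove
        refine ⟨⟨o', C.head + shift d, Function.update C.cell C.head s'⟩,
          hC.tail ⟨s', d, hτ, rfl, rfl⟩, y, hmove, fun r => symbolAt ?_⟩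
        dsimp only
        by_cases hr : r = x₀
        · subst hr
          rw [hy', Function.update_self]
          exact hat
        · rw [Function.update_of_ne (by rw [← hy']; exact fun h => hr (hz.injective h))]
          exact hrest r hr _ (hcell r)
  obtain ⟨t, r, ⟨s, o, ho⟩, hcell⟩ := h.accepting
  obtain ⟨C, hC, y, -, hrep⟩ := rep t
  refine (accepts_iff x).2 ⟨C, hC, ?_⟩
  have := (Prod.mk.inj (unique hcell (hrep r))).2
  dsimp only at this
  split_ifs at this
  cases this
  exact ho

open Classical in
/-- An accepting run yields space-time diagrams on all sufficiently large domains. -/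
theorem exists_isDiagram {x : List Bool} (hacc : M.Accepts x) : ∃ N₀, ∀ {D : Type*} {N : ℕ}
    (_ : N₀ ≤ N) (g : D ≃ Fin N) {n : ℕ} {e : Fin n → D} (_ : ∀ i, (g (e i) : ℕ) = i) {fresh : D → Prop}
    (_ : ∀ x, ¬ fresh x ↔ ∃ i, e i = x) {bit : ∀ i, (Fin (K i) → D) → Prop}
    (_ : x = (blockTuples n K).map fun w => decide (bit w.1 (e ∘ w.2))),
    ∃ cell pos, IsDiagram M K fresh bit (fun x y => g x < g y) cell pos := by
  obtain ⟨C, hC, hCacc⟩ := (accepts_iff x).1 hacc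
  obtain ⟨T, s, hs₀, hsT, hstep, hhead⟩ := exists_run hC
  -- With the origin at rank `T`, this leaves `T` cells to its left and at least `T + x.length` to
  -- its right: room for the input and for every head position within `T` steps.
  refine ⟨2 * T + x.length + 1, fun {D N} hN g {n} e he fresh hrange bit hx => ?_⟩
  have hlen : x.length = (blockTuples n K).length := by rw [hx, List.length_map]
  have heinj : Function.Injective e := fun i j hij => Fin.ext (by rw [← he i, ← he j, hij])
  set c : D := g.symm ⟨T, by omega⟩ with hc
  have hz := isCoordinate_of_equiv g c
  set z : D → ℤ := fun x => (g x : ℤ) - g c with hzdef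
  have hgc : (g c : ℕ) = T := by rw [hc, Equiv.apply_symm_apply]
  have exists_at : ∀ k : ℤ, -T ≤ k → k ≤ T + x.length → ∃ w, z w = k := by
    intro k h₁ h₂
    refine ⟨g.symm ⟨(k + T).toNat, by omega⟩, ?_⟩
    simp only [hzdef, Equiv.apply_symm_apply, hgc]
    omega
  -- Surplus times after `T` repeat the initial configuration, which the axioms permit at any time.
  let conf : D → M.AbsConfig := fun t => if (g t : ℕ) ≤ T then s (g t) else s 0
  let cell : M.Symbol × Option M.State → D → D → Prop := fun κ t r =>
    κ = ((conf t).cell (z r), if z r = (conf t).head then some (conf t).state else none)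
  let pos : ∀ i, (Fin (K i) → D) → D → Prop := fun i u y =>
    ∃ (u' : Fin (K i) → Fin n) (j : ℕ) (hj : j < (blockTuples n K).length),
      e ∘ u' = u ∧ (blockTuples n K)[j] = ⟨i, u'⟩ ∧ z y = j
  have symbolAt : ∀ {o a y t r}, (conf t).state = o → (conf t).cell (z r) = a →
      (conf t).head = z y → SymbolAt M cell o a y t r := by
    rintro o a y t r rfl rfl hy
    refine ⟨fun hr => ?_, fun hr => ?_⟩
    · simp only [cell, hy, hr, if_true]
    · simp only [cell, hy, hz.injective.eq_iff, hr, if_false]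
  have posOf : ∀ (i) (u' : Fin (K i) → Fin n) (y : D), (∃ (j : ℕ) (hj : j <
      (blockTuples n K).length), (blockTuples n K)[j] = ⟨i, u'⟩ ∧ z y = j) → pos i (e ∘ u') y :=
    fun i u' y ⟨j, hj, h₁, h₂⟩ => ⟨u', j, hj, rfl, h₁, h₂⟩
  refine ⟨cell, pos, fun _ => lt_irrefl _, fun _ _ _ => lt_trans, fun x y => ?_, ?_, ?_, ?_, ?_,
    ?_, ?_, ⟨c, ?_, ?_, ?_⟩, ?_⟩
  · rcases lt_trichotomy (g x) (g y) with h | h | h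
    · exact Or.inl h
    · exact Or.inr (Or.inl (g.injective h))
    · exact Or.inr (Or.inr h)
  · exact fun t r κ κ' hne h h' => hne (h.trans h'.symm)
  · intro i u hu
    choose u' hu' using fun j => (hrange (u j)).1 (hu j)
    obtain rfl : e ∘ u' = u := funext hu'
    obtain ⟨j, hj, hw⟩ := List.getElem_of_mem (mem_blockTuples K ⟨i, u'⟩)
    obtain ⟨y, hy⟩ := exists_at j (by omega) (by omega)
    exact ⟨y, posOf _ _ _ ⟨j, hj, hw, hy⟩⟩
  · rintro i u y ⟨u', j, hj, rfl, -, -⟩ k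
    exact (hrange _).2 ⟨_, rfl⟩
  · rintro i u y y' ⟨u', j, hj, rfl, hw, hy⟩ ⟨v', k, hk, huv, hw', hy'⟩
    obtain rfl : v' = u' := heinj.comp_left huv
    obtain rfl : j = k := (nodup_blockTuples n K).getElem_inj_iff.1 (hw.trans hw'.symm)
    exact hz.injective (hy.trans hy'.symm)
  · rintro i u v y y' huv ⟨u', j, hj, rfl, hw, hy⟩ ⟨v', k, hk, rfl, hw', hy'⟩
    have hlt : TupleLt (· < ·) u' v' := by
      obtain ⟨l, h₁, h₂⟩ := huv
      refine ⟨l, fun i hi => heinj (h₁ i hi), ?_⟩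
      have h₃ : (g (e (u' l)) : ℕ) < g (e (v' l)) := h₂
      rwa [he, he] at h₃
    have hjk : j < k := lt_of_blockLt_getElem hj hk (by
      rw [hw, hw']
      exact Sigma.Lex.right _ _ hlt)
    refine (hz.lt_iff y y').2 ?_
    rw [hy, hy']
    exact_mod_cast hjk
  · rintro i i' hii' u v y y' ⟨u', j, hj, rfl, hw, hy⟩ ⟨v', k, hk, rfl, hw', hy'⟩
    have hjk : j < k := lt_of_blockLt_getElem hj hk (by
      rw [hw, hw']
      exact Sigma.Lex.left _ _ hii')
    refine (hz.lt_iff y y').2 ?_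
    rw [hy, hy']
    exact_mod_cast hjk
  · rintro i u y ⟨u', j, hj, rfl, hw, hy⟩ hlt
    have := (hz.lt_iff y c).1 hlt
    rw [hz.origin, hy] at this
    omega
  · intro y hy
    have hy₀ : 0 ≤ z y := by
      rw [← hz.origin]
      exact not_lt.1 fun h => hy ((hz.lt_iff y c).2 h)
    by_cases hlt : (z y).toNat < (blockTuples n K).length
    · exact Or.inl ⟨_, _, posOf _ (blockTuples n K)[(z y).toNat].2 y ⟨_, hlt, rfl, by omega⟩⟩
    · refine Or.inr ?_
      rintro i u w ⟨u', j, hj, rfl, hw, hzw⟩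
      refine (hz.lt_iff w y).2 ?_
      rw [hzw]
      omega
  · intro t
    by_cases ht : (conf t) = s 0
    · refine Or.inl fun r => ⟨?_, fun hr => ?_⟩
      · rintro i u ⟨u', j, hj, rfl, hw, hzr⟩
        have hcell : (conf t).cell (z r) = M.input (decide (bit i (e ∘ u'))) := by
          rw [ht, hs₀, hzr, hx]
          exact (inputCell_of_bit hj).trans (by rw [hw])
        have h₁ : (conf t).state = M.start := by rw [ht, hs₀, absInit]
        have h₂ : (conf t).head = z c := by rw [ht, hs₀, absInit, hz.origin]
        refine ⟨fun hb => symbolAt h₁ ?_ h₂, fun hb => symbolAt h₁ ?_ h₂⟩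
        · rw [hcell, decide_eq_true hb]
        · rw [hcell, decide_eq_false hb]
      · refine symbolAt (by rw [ht, hs₀, absInit]) ?_ (by rw [ht, hs₀, absInit, hz.origin])
        rw [ht, hs₀]
        refine inputCell_of_notMem fun j hj hzr => hr _ _ (posOf _ _ r ⟨j, hlen ▸ hj, rfl, hzr⟩)
    · obtain ⟨k, hk⟩ : ∃ k, (g t : ℕ) = k + 1 := by
        refine Nat.exists_eq_succ_of_ne_zero fun h => ht ?_
        simp only [conf, h, zero_le, if_true]
      have hkT : k + 1 ≤ T := by
        by_contra hlt
        exact ht (if_neg (by omega))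
      have hct : conf t = s (k + 1) := by simp only [conf, hk, hkT, if_true]
      obtain ⟨t', hgt'⟩ : ∃ t', (g t' : ℕ) = k :=
        ⟨g.symm ⟨k, by omega⟩, by rw [Equiv.apply_symm_apply]⟩
      have hct' : conf t' = s k := by
        simp only [conf, hgt', (Nat.le_succ k).trans hkT, if_true]
      have hh₁ := abs_le.1 (hhead k (by omega))
      have hh₂ := abs_le.1 (hhead (k + 1) hkT)
      obtain ⟨w, hw⟩ := exists_at (s k).head (by omega) (by omega)
      obtain ⟨y, hy⟩ := exists_at (s (k + 1)).head (by omega) (by omega)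
      obtain ⟨b, d, htr, hcell, hhd⟩ := hstep k (by omega)
      refine Or.inr ⟨t', by rw [Fin.lt_def]; omega, w, y,
        ⟨(((s k).state, (s k).cell (s k).head), (s (k + 1)).state, b, d), htr⟩,
        ?_, ?_, ?_, ?_⟩
      · rw [hz.isMove_iff, hw, hy, hhd]
      · change _ = ((conf t').cell (z w), _)
        rw [hct', hw, if_pos rfl]
      · refine symbolAt (by rw [hct]) ?_ (by rw [hct, hy])
        rw [hct, hcell, hw, Function.update_self]
      · rintro r hr κ rfl
        refine symbolAt (by rw [hct]) ?_ (by rw [hct, hy])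
        rw [hct, hct', hcell, Function.update_of_ne]
        rw [← hw]
        exact fun h => hr (hz.injective h)
  · obtain ⟨w, hw⟩ := exists_at (s T).head (by have := abs_le.1 (hhead T le_rfl); omega)
      (by have := abs_le.1 (hhead T le_rfl); omega)
    -- The origin has rank `T`, so, taken as a time, it carries the last configuration.
    have hcc : conf c = s T := by simp only [conf, hgc, le_refl, if_true]
    refine ⟨c, w, ⟨(s T).cell (s T).head, (s T).state, hsT ▸ hCacc⟩, ?_⟩
    simp only [cell, hcc, hw, if_true]

end Diagram

end LRE

namespace LRE

open FirstOrder FirstOrder.Language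

universe a b c

/-! ### A first-order axiomatization of space-time diagrams -/

section Formulas

variable {L : FirstOrder.Language.{a, b}} {α : Type} {D : Type c} [L.Structure D]

/-- Universal quantification over one new variable. -/
noncomputable def allF (φ : L.Formula (α ⊕ Unit)) : L.Formula α :=
  φ.iAlls Unit

/-- Existential quantification over one new variable. -/
noncomputable def exF (φ : L.Formula (α ⊕ Unit)) : L.Formula α :=
  φ.iExs Unit

/-- Equality of two variables. -/
def eqF (x y : α) : L.Formula α :=
  (Term.var x : L.Term α).equal (Term.var y)

theorem realize_allF (φ : L.Formula (α ⊕ Unit)) (v : α → D) :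
    (allF φ).Realize v ↔ ∀ x, φ.Realize (Sum.elim v fun _ => x) := by
  rw [allF, Formula.realize_iAlls]
  exact ⟨fun h x => h fun _ => x, fun h i => h (i ())⟩

theorem realize_exF (φ : L.Formula (α ⊕ Unit)) (v : α → D) :
    (exF φ).Realize v ↔ ∃ x, φ.Realize (Sum.elim v fun _ => x) := by
  rw [exF, Formula.realize_iExs]
  exact ⟨fun ⟨i, h⟩ => ⟨i (), h⟩, fun ⟨x, h⟩ => ⟨fun _ => x, h⟩⟩

theorem realize_allTupleF {k : ℕ} (φ : L.Formula (α ⊕ Fin k)) (v : α → D) :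
    (φ.iAlls (Fin k)).Realize v ↔ ∀ u, φ.Realize (Sum.elim v u) :=
  Formula.realize_iAlls

theorem realize_exTupleF {k : ℕ} (φ : L.Formula (α ⊕ Fin k)) (v : α → D) :
    (φ.iExs (Fin k)).Realize v ↔ ∃ u, φ.Realize (Sum.elim v u) :=
  Formula.realize_iExs

theorem realize_eqF (x y : α) (v : α → D) : (eqF x y : L.Formula α).Realize v ↔ v x = v y := by
  simp [eqF]

theorem realize_iInfF {ι : Type} [Finite ι] (f : ι → L.Formula α) (v : α → D) :
    (Formula.iInf f).Realize v ↔ ∀ i, (f i).Realize v :=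
  BoundedFormula.realize_iInf

theorem realize_iSupF {ι : Type} [Finite ι] (f : ι → L.Formula α) (v : α → D) :
    (Formula.iSup f).Realize v ↔ ∃ i, (f i).Realize v :=
  BoundedFormula.realize_iSup

end Formulas

/-- The symbols of a vocabulary in which space-time diagrams are described, and formulas for the
bits of the input. -/
structure DiagramVocabulary (M : TuringMachine) {q : ℕ} (K : Fin q → ℕ)
    (L : FirstOrder.Language.{a, b}) where
  lt : L.Relations 2
  cell : M.Symbol × Option M.State → L.Relations 2
  pos : ∀ i, L.Relations (K i + 1)
  fresh : L.Relations 1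
  bit : ∀ i, L.Formula (Fin (K i))

namespace DiagramVocabulary

variable {M : TuringMachine} {q : ℕ} {K : Fin q → ℕ} {L : FirstOrder.Language.{a, b}}
  (V : DiagramVocabulary M K L) {α : Type} (D : Type c) [L.Structure D]

/-- The order of a diagram. -/
def Lt (x y : D) : Prop :=
  Structure.RelMap V.lt ![x, y]

/-- The cells of a diagram. -/
def Cell (κ : M.Symbol × Option M.State) (t r : D) : Prop :=
  Structure.RelMap (V.cell κ) ![t, r]

/-- The positions of the input bits in a diagram. -/
def Pos (i : Fin q) (u : Fin (K i) → D) (x : D) : Prop :=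
  Structure.RelMap (V.pos i) (Fin.cons x u : Fin (K i + 1) → D)

/-- The new elements of a diagram. -/
def Fresh (x : D) : Prop :=
  Structure.RelMap V.fresh ![x]

/-- The input bits of a diagram. -/
def Bit (i : Fin q) (u : Fin (K i) → D) : Prop :=
  (V.bit i).Realize u

variable {D}

/-- The formula `x < y`. -/
def ltF (x y : α) : L.Formula α :=
  V.lt.formula₂ (Term.var x) (Term.var y)

/-- The formula for `Cell`. -/
def cellF (κ : M.Symbol × Option M.State) (t r : α) : L.Formula α :=
  (V.cell κ).formula₂ (Term.var t) (Term.var r)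

/-- The formula for `Pos`. -/
def posF (i : Fin q) (u : Fin (K i) → α) (x : α) : L.Formula α :=
  (V.pos i).formula fun j => Term.var ((Fin.cons x u : Fin (K i + 1) → α) j)

/-- The formula for `Fresh`. -/
def freshF (x : α) : L.Formula α :=
  V.fresh.formula₁ (Term.var x)

/-- The formula for `Bit`. -/
def bitF (i : Fin q) (u : Fin (K i) → α) : L.Formula α :=
  (V.bit i).relabel u

theorem realize_ltF (x y : α) (v : α → D) : (V.ltF x y).Realize v ↔ V.Lt D (v x) (v y) := by
  simp [ltF, Lt, Formula.realize_rel₂]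

theorem realize_cellF (κ : M.Symbol × Option M.State) (t r : α) (v : α → D) :
    (V.cellF κ t r).Realize v ↔ V.Cell D κ (v t) (v r) := by
  simp [cellF, Cell, Formula.realize_rel₂]

theorem realize_posF (i : Fin q) (u : Fin (K i) → α) (x : α) (v : α → D) :
    (V.posF i u x).Realize v ↔ V.Pos D i (fun j => v (u j)) (v x) := by
  rw [posF, Pos, Formula.realize_rel]
  refine iff_of_eq (congrArg _ (funext fun j => ?_))
  refine Fin.cases rfl (fun j => rfl) j

theorem realize_freshF (x : α) (v : α → D) : (V.freshF x).Realize v ↔ V.Fresh D (v x) := by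
  simp [freshF, Fresh, Formula.realize_rel₁]

theorem realize_bitF (i : Fin q) (u : Fin (K i) → α) (v : α → D) :
    (V.bitF i u).Realize v ↔ V.Bit D i (fun j => v (u j)) := by
  rw [bitF, Formula.realize_relabel]
  rfl

/-- The formula for `TupleLt`. -/
noncomputable def tupleLtF {k : ℕ} (u v : Fin k → α) : L.Formula α :=
  Formula.iSup fun j => (Formula.iInf fun i : {i // i < j} => eqF (u i) (v i)) ⊓ V.ltF (u j) (v j)

theorem realize_tupleLtF {k : ℕ} (u w : Fin k → α) (v : α → D) :
    (V.tupleLtF u w).Realize v ↔ TupleLt (V.Lt D) (fun j => v (u j)) fun j => v (w j) := by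
  simp only [tupleLtF, realize_iSupF, Formula.realize_inf, realize_iInfF, realize_eqF,
    V.realize_ltF, TupleLt, Subtype.forall]

/-- The formula for `SymbolAt`. -/
def symbolAtF (o : M.State) (s : M.Symbol) (h t r : α) : L.Formula α :=
  ((eqF r h).imp (V.cellF (s, some o) t r)) ⊓ ((eqF r h).not.imp (V.cellF (s, none) t r))

theorem realize_symbolAtF (o : M.State) (s : M.Symbol) (h t r : α) (v : α → D) :
    (V.symbolAtF o s h t r).Realize v ↔ SymbolAt M (V.Cell D) o s (v h) (v t) (v r) := by
  simp only [symbolAtF, SymbolAt, Formula.realize_inf, Formula.realize_imp, Formula.realize_not,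
    realize_eqF, V.realize_cellF]

/-- The formula for `IsNext`. -/
noncomputable def nextF (x y : α) : L.Formula α :=
  V.ltF x y ⊓ allF (V.ltF (Sum.inl x) (Sum.inr ()) ⊓ V.ltF (Sum.inr ()) (Sum.inl y)).not

theorem realize_nextF (x y : α) (v : α → D) :
    (V.nextF x y).Realize v ↔ IsNext (V.Lt D) (v x) (v y) := by
  simp only [nextF, IsNext, Formula.realize_inf, realize_allF, Formula.realize_not,
    V.realize_ltF, Sum.elim_inl, Sum.elim_inr]

/-- The formula for `IsMove`. -/
noncomputable def moveF (x y : α) : Option Turing.Dir → L.Formula α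
  | none => eqF x y
  | some .left => V.nextF y x
  | some .right => V.nextF x y

theorem realize_moveF (x y : α) (d : Option Turing.Dir) (v : α → D) :
    (V.moveF x y d).Realize v ↔ IsMove (V.Lt D) (v x) (v y) d := by
  rcases d with _ | _ | _
  · exact realize_eqF _ _ _
  · exact V.realize_nextF _ _ _
  · exact V.realize_nextF _ _ _

instance finite_dir : Finite Turing.Dir :=
  Finite.of_injective (fun | .left => false | .right => true : Turing.Dir → Bool) fun a b h => by
    cases a <;> cases b <;> simp_all

/-- The formula for `DiagramStep`. -/
noncomputable def stepF (t' t : α) : L.Formula α :=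
  exF <| exF <| Formula.iSup fun τ : Transition M =>
    V.moveF (Sum.inl (Sum.inr ())) (Sum.inr ()) τ.1.2.2.2 ⊓
    (V.cellF (τ.1.1.2, some τ.1.1.1) (Sum.inl (Sum.inl t')) (Sum.inl (Sum.inr ())) ⊓
    (V.symbolAtF τ.1.2.1 τ.1.2.2.1 (Sum.inr ()) (Sum.inl (Sum.inl t)) (Sum.inl (Sum.inr ())) ⊓
    allF ((eqF (Sum.inr ()) (Sum.inl (Sum.inl (Sum.inr ())))).not.imp
      (Formula.iInf fun κ : M.Symbol × Option M.State =>
        (V.cellF κ (Sum.inl (Sum.inl (Sum.inl t'))) (Sum.inr ())).imp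
          (V.symbolAtF τ.1.2.1 κ.1 (Sum.inl (Sum.inr ())) (Sum.inl (Sum.inl (Sum.inl t)))
            (Sum.inr ()))))))

theorem realize_stepF (t' t : α) (v : α → D) :
    (V.stepF t' t).Realize v ↔ DiagramStep M (V.Lt D) (V.Cell D) (v t') (v t) := by
  simp only [stepF, DiagramStep, realize_exF, realize_iSupF, Formula.realize_inf, realize_allF,
    Formula.realize_imp, Formula.realize_not, realize_iInfF, realize_eqF, V.realize_cellF,
    V.realize_moveF, V.realize_symbolAtF, Sum.elim_inl, Sum.elim_inr]

/-- The formula for `DiagramInit`. -/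
noncomputable def initF (c t : α) : L.Formula α :=
  allF <| (Formula.iInf fun i => Formula.iAlls (Fin (K i)) <|
      (V.posF i Sum.inr (Sum.inl (Sum.inr ()))).imp
        (((V.bitF i Sum.inr).imp (V.symbolAtF M.start (M.input true) (Sum.inl (Sum.inl c))
          (Sum.inl (Sum.inl t)) (Sum.inl (Sum.inr ())))) ⊓
        ((V.bitF i Sum.inr).not.imp (V.symbolAtF M.start (M.input false) (Sum.inl (Sum.inl c))
          (Sum.inl (Sum.inl t)) (Sum.inl (Sum.inr ())))))) ⊓
    ((Formula.iInf fun i => Formula.iAlls (Fin (K i)) <|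
        (V.posF i Sum.inr (Sum.inl (Sum.inr ()))).not).imp
      (V.symbolAtF M.start default (Sum.inl c) (Sum.inl t) (Sum.inr ())))

theorem realize_initF (c t : α) (v : α → D) :
    (V.initF c t).Realize v ↔ DiagramInit M K (V.Bit D) (V.Cell D) (V.Pos D) (v c) (v t) := by
  simp only [initF, DiagramInit, realize_iInfF, Formula.realize_inf, realize_allF,
    realize_allTupleF, Formula.realize_imp, Formula.realize_not, V.realize_posF, V.realize_bitF,
    V.realize_symbolAtF, Sum.elim_inl, Sum.elim_inr]

/-- The axioms of a linear order. -/
noncomputable def orderF : L.Formula α :=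
  allF (V.ltF (Sum.inr ()) (Sum.inr ())).not ⊓
  (allF <| allF <| allF <| (V.ltF (Sum.inl (Sum.inl (Sum.inr ()))) (Sum.inl (Sum.inr ()))).imp <|
    (V.ltF (Sum.inl (Sum.inr ())) (Sum.inr ())).imp
      (V.ltF (Sum.inl (Sum.inl (Sum.inr ()))) (Sum.inr ()))) ⊓
  (allF <| allF <| V.ltF (Sum.inl (Sum.inr ())) (Sum.inr ()) ⊔
    (eqF (Sum.inl (Sum.inr ())) (Sum.inr ()) ⊔ V.ltF (Sum.inr ()) (Sum.inl (Sum.inr ()))))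

theorem realize_orderF (v : α → D) : (V.orderF : L.Formula α).Realize v ↔
    ((∀ x, ¬ V.Lt D x x) ∧ (∀ x y z, V.Lt D x y → V.Lt D y z → V.Lt D x z)) ∧
      ∀ x y, V.Lt D x y ∨ x = y ∨ V.Lt D y x := by
  simp only [orderF, Formula.realize_inf, Formula.realize_sup, realize_allF, Formula.realize_imp,
    Formula.realize_not, realize_eqF, V.realize_ltF, Sum.elim_inl, Sum.elim_inr]

/-- The axiom that cells have unique contents, and the one that some cell holds an accepting
state. -/
noncomputable def contentF : L.Formula α :=
  (allF <| allF <| Formula.iInf fun κ : M.Symbol × Option M.State =>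
    Formula.iInf fun κ' : {κ' // ¬ κ = κ'} =>
      (V.cellF κ (Sum.inl (Sum.inr ())) (Sum.inr ())).imp
        (V.cellF κ' (Sum.inl (Sum.inr ())) (Sum.inr ())).not) ⊓
  (exF <| exF <| Formula.iSup fun κ : M.Symbol × M.accept =>
    V.cellF (κ.1, some κ.2) (Sum.inl (Sum.inr ())) (Sum.inr ()))

theorem realize_contentF (v : α → D) : (V.contentF : L.Formula α).Realize v ↔
    (∀ t r κ κ', ¬ κ = κ' → V.Cell D κ t r → ¬ V.Cell D κ' t r) ∧
      ∃ t r, ∃ κ : M.Symbol × M.accept, V.Cell D (κ.1, some κ.2) t r := by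
  simp only [contentF, Formula.realize_inf, realize_allF, realize_exF, realize_iInfF,
    realize_iSupF, Formula.realize_imp, Formula.realize_not, V.realize_cellF, Sum.elim_inl,
    Sum.elim_inr, Subtype.forall]

/-- The axioms on the positions of the input bits. -/
noncomputable def positionF : L.Formula α :=
  (Formula.iInf fun i => Formula.iAlls (Fin (K i)) <|
    (Formula.iInf fun j => (V.freshF (Sum.inr j)).not).imp
      (exF (V.posF i (fun j => Sum.inl (Sum.inr j)) (Sum.inr ())))) ⊓
  ((Formula.iInf fun i => Formula.iAlls (Fin (K i)) <| allF <|
    (V.posF i (fun j => Sum.inl (Sum.inr j)) (Sum.inr ())).imp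
      (Formula.iInf fun j => (V.freshF (Sum.inl (Sum.inr j))).not)) ⊓
  ((Formula.iInf fun i => Formula.iAlls (Fin (K i)) <| allF <| allF <|
    (V.posF i (fun j => Sum.inl (Sum.inl (Sum.inr j))) (Sum.inl (Sum.inr ()))).imp <|
    (V.posF i (fun j => Sum.inl (Sum.inl (Sum.inr j))) (Sum.inr ())).imp <|
      eqF (Sum.inl (Sum.inr ())) (Sum.inr ())) ⊓
  ((Formula.iInf fun i => Formula.iAlls (Fin (K i)) <| Formula.iAlls (Fin (K i)) <|
    allF <| allF <|
    (V.tupleLtF (fun j => Sum.inl (Sum.inl (Sum.inl (Sum.inr j))))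
      fun j => Sum.inl (Sum.inl (Sum.inr j))).imp <|
    (V.posF i (fun j => Sum.inl (Sum.inl (Sum.inl (Sum.inr j)))) (Sum.inl (Sum.inr ()))).imp <|
    (V.posF i (fun j => Sum.inl (Sum.inl (Sum.inr j))) (Sum.inr ())).imp <|
      V.ltF (Sum.inl (Sum.inr ())) (Sum.inr ())) ⊓
  (Formula.iInf fun i => Formula.iInf fun i' : {i' // i < i'} =>
    Formula.iAlls (Fin (K i)) <| Formula.iAlls (Fin (K i')) <| allF <| allF <|
    (V.posF i (fun j => Sum.inl (Sum.inl (Sum.inl (Sum.inr j)))) (Sum.inl (Sum.inr ()))).imp <|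
    (V.posF i' (fun j => Sum.inl (Sum.inl (Sum.inr j))) (Sum.inr ())).imp <|
      V.ltF (Sum.inl (Sum.inr ())) (Sum.inr ())))))

theorem realize_positionF (v : α → D) : (V.positionF : L.Formula α).Realize v ↔
    (∀ i u, (∀ j, ¬ V.Fresh D (u j)) → ∃ x, V.Pos D i u x) ∧
    (∀ i u x, V.Pos D i u x → ∀ j, ¬ V.Fresh D (u j)) ∧
    (∀ i u x y, V.Pos D i u x → V.Pos D i u y → x = y) ∧
    (∀ i u v x y, TupleLt (V.Lt D) u v → V.Pos D i u x → V.Pos D i v y → V.Lt D x y) ∧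
    ∀ i j, i < j → ∀ u v x y, V.Pos D i u x → V.Pos D j v y → V.Lt D x y := by
  simp only [positionF, Formula.realize_inf, realize_allF, realize_exF, realize_iInfF,
    realize_allTupleF, Formula.realize_imp, Formula.realize_not, realize_eqF, V.realize_freshF,
    V.realize_posF, V.realize_ltF, V.realize_tupleLtF, Sum.elim_inl, Sum.elim_inr,
    Subtype.forall]

/-- The axiom that the positions of the input bits start at some origin without gaps, and that
every configuration is initial or the successor of one at an earlier time. -/
noncomputable def runF : L.Formula α :=
  exF <| (Formula.iInf fun i => Formula.iAlls (Fin (K i)) <| allF <|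
    (V.posF i (fun j => Sum.inl (Sum.inr j)) (Sum.inr ())).imp
      (V.ltF (Sum.inr ()) (Sum.inl (Sum.inl (Sum.inr ())))).not) ⊓
  ((allF <| (V.ltF (Sum.inr ()) (Sum.inl (Sum.inr ()))).not.imp
    ((Formula.iSup fun i => Formula.iExs (Fin (K i)) (V.posF i Sum.inr (Sum.inl (Sum.inr ())))) ⊔
    (Formula.iInf fun i => Formula.iAlls (Fin (K i)) <| allF <|
      (V.posF i (fun j => Sum.inl (Sum.inr j)) (Sum.inr ())).imp
        (V.ltF (Sum.inr ()) (Sum.inl (Sum.inl (Sum.inr ()))))))) ⊓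
  (allF <| V.initF (Sum.inl (Sum.inr ())) (Sum.inr ()) ⊔
    exF (V.ltF (Sum.inr ()) (Sum.inl (Sum.inr ())) ⊓ V.stepF (Sum.inr ()) (Sum.inl (Sum.inr ())))))

theorem realize_runF (v : α → D) : (V.runF : L.Formula α).Realize v ↔
    ∃ c, (∀ i u x, V.Pos D i u x → ¬ V.Lt D x c) ∧
    (∀ y, ¬ V.Lt D y c → (∃ i u, V.Pos D i u y) ∨ ∀ i u x, V.Pos D i u x → V.Lt D x y) ∧
    ∀ t, DiagramInit M K (V.Bit D) (V.Cell D) (V.Pos D) c t ∨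
      ∃ t', V.Lt D t' t ∧ DiagramStep M (V.Lt D) (V.Cell D) t' t := by
  simp only [runF, Formula.realize_inf, Formula.realize_sup, realize_allF, realize_exF,
    realize_iInfF, realize_iSupF, realize_allTupleF, realize_exTupleF, Formula.realize_imp,
    Formula.realize_not, V.realize_posF, V.realize_ltF, V.realize_initF, V.realize_stepF,
    Sum.elim_inl, Sum.elim_inr]

/-- The sentence that axiomatizes space-time diagrams. -/
noncomputable def sentence : L.Sentence :=
  V.orderF ⊓ (V.contentF ⊓ (V.positionF ⊓ V.runF))

variable (D) in
-- States, symbols, transitions and blocks are finite in number, so quantification over them becomes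
-- finite conjunction and disjunction; the remaining quantifiers range over elements or tuples of
-- fixed length.
theorem realize_sentence : D ⊨ V.sentence ↔
    IsDiagram M K (V.Fresh D) (V.Bit D) (V.Lt D) (V.Cell D) (V.Pos D) := by
  rw [FirstOrder.Language.Sentence.Realize, sentence, Formula.realize_inf, Formula.realize_inf,
    Formula.realize_inf, V.realize_orderF, V.realize_contentF, V.realize_positionF, V.realize_runF]
  constructor
  · rintro ⟨⟨⟨h₁, h₂⟩, h₃⟩, ⟨h₄, h₅⟩, ⟨h₆, h₇, h₈, h₉, h₁₀⟩, h₁₁⟩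
    exact ⟨h₁, h₂, h₃, h₄, h₆, h₇, h₈, h₉, h₁₀, h₁₁, h₅⟩
  · rintro ⟨h₁, h₂, h₃, h₄, h₆, h₇, h₈, h₉, h₁₀, h₁₁, h₅⟩
    exact ⟨⟨⟨h₁, h₂⟩, h₃⟩, ⟨h₄, h₅⟩, ⟨h₆, h₇, h₈, h₉, h₁₀⟩, h₁₁⟩

end DiagramVocabulary

end LRE

namespace LRE

open FirstOrder FirstOrder.Language

universe a b c

/-! ### The acceptance sentence and definability of semi-decidable classes -/

section Main

/-- Relation variables indexed by any finite type can be interpreted at will. -/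
theorem exists_relVar_structure {ι : Type} {n : ℕ} (ε : ι ≃ Fin n) (ar : ι → ℕ) {D : Type c}
    (interp : ∀ v, (Fin (ar v) → D) → Prop) :
    ∃ X : (relVarLang (ar ∘ ε.symm)).Structure D, ∀ v (h : (ar ∘ ε.symm) (ε v) = ar v)
      (t : Fin (ar v) → D), X.RelMap (⟨ε v, h⟩ : (relVarLang (ar ∘ ε.symm)).Relations (ar v)) t ↔
        interp v t := by
  refine ⟨{ funMap := fun f _ => isEmptyElim f
            RelMap := fun i t => interp (ε.symm i.1) (t ∘ Fin.cast i.2) }, fun v h t => ?_⟩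
  have key : ∀ w (hw : w = v) (h : ar w = ar v), interp w (t ∘ Fin.cast h) ↔ interp v t := by
    rintro w rfl h
    rfl
  exact key _ (ε.symm_apply_apply v) h

variable (M : TuringMachine) {q : ℕ} (K : Fin q → ℕ)

/-- Indices of the relation variables that describe a space-time diagram. -/
abbrev DiagramVar : Type :=
  Unit ⊕ (M.Symbol × Option M.State) ⊕ Fin q

/-- The arities of the relation variables that describe a space-time diagram. -/
def diagramArity : DiagramVar M (q := q) → ℕ
  | Sum.inl _ => 2
  | Sum.inr (Sum.inl _) => 2
  | Sum.inr (Sum.inr i) => K i + 1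

/-- The arities of the relation variables in the order in which they are quantified. -/
noncomputable abbrev varArity : Fin (Nat.card (DiagramVar M (q := q))) → ℕ :=
  diagramArity M K ∘ (Finite.equivFin (DiagramVar M (q := q))).symm

/-- The relation variable with a given index. -/
noncomputable def varSymbol (v : DiagramVar M (q := q)) :
    (relVarLang (varArity M K)).Relations (diagramArity M K v) :=
  ⟨Finite.equivFin _ v, by simp [varArity]⟩

variable {L : FirstOrder.Language.{a, b}} {p : ℕ} (ord : Fin p ≃ Σ k, L.Relations k)

/-- The vocabulary for diagrams of runs of `M` on encodings of `L`-models. -/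
noncomputable def encVocabulary : DiagramVocabulary M (blockArity ord)
    ((L.sum markLang).sum (relVarLang (varArity M (blockArity ord)))) where
  lt := Sum.inr (varSymbol M (blockArity ord) (Sum.inl ()))
  cell κ := Sum.inr (varSymbol M (blockArity ord) (Sum.inr (Sum.inl κ)))
  pos i := Sum.inr (varSymbol M (blockArity ord) (Sum.inr (Sum.inr i)))
  fresh := Sum.inl (Sum.inr MarkRel.Y)
  bit := Fin.cases (⊥ : FirstOrder.Language.Formula _ (Fin 1))
    (Fin.cases (⊤ : FirstOrder.Language.Formula _ (Fin 0)) fun i =>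
      Relations.formula (L := (L.sum markLang).sum (relVarLang (varArity M (blockArity ord))))
        (Sum.inl (Sum.inl (ord i).2)) Term.var)

/-- The `L_RE` sentence that says that `M` accepts an encoding. -/
noncomputable def acceptanceSentence : Sentence L where
  body :=
    { numVars := _
      arity := varArity M (blockArity ord)
      body := (encVocabulary M ord).sentence }

section Plus

variable [L.IsRelational] (A : Type c) [L.Structure A] (S : Type)
  (X : (relVarLang (varArity M (blockArity ord))).Structure (A ⊕ S))

/-- The expansion of `A⁺` by an interpretation of the relation variables. -/
@[reducible]
noncomputable def expansion : ((L.sum markLang).sum (relVarLang (varArity M (blockArity ord)))).Structure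
    (A ⊕ S) :=
  @FirstOrder.Language.sumStructure _ _ (A ⊕ S) (plusStructure L A S) X

theorem not_fresh_iff (x : A ⊕ S) :
    ¬ @DiagramVocabulary.Fresh _ _ _ _ (encVocabulary M ord) (A ⊕ S) (expansion M ord A S X) x ↔
      ∃ y, Sum.inl y = x := by
  have : @DiagramVocabulary.Fresh _ _ _ _ (encVocabulary M ord) (A ⊕ S)
      (expansion M ord A S X) x ↔ ∀ i : Fin 1, ∃ s : S, ![x] i = Sum.inr s := Iff.rfl
  rw [this]
  rcases x with x | x <;> simp

/-- Relations of `A⁺` hold only of old tuples, the block of zeros has no true bit, and the separator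
is indexed by the empty tuple. In particular, the bits do not depend on `X`. -/
theorem bit_iff (i : Fin (p + 2)) (u : Fin (blockArity ord i) → A ⊕ S) :
    @DiagramVocabulary.Bit _ _ _ _ (encVocabulary M ord) (A ⊕ S) (expansion M ord A S X) i u ↔
      ∃ y, u = Sum.inl ∘ y ∧ BlockBit ord i y := by
  let _ := expansion M ord A S X
  revert u
  refine Fin.cases (fun u => ?_) (fun i => Fin.cases (fun u => ?_) (fun i u => ?_) i) i
  · exact iff_of_false (fun h => h) fun ⟨_, _, h⟩ => h
  · exact iff_of_true (Formula.realize_top.2 trivial) ⟨Fin.elim0, funext fun j => j.elim0, trivial⟩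
  · exact Formula.realize_rel

end Plus

open Classical in
theorem word_eq_enc [L.IsRelational] {A : Type c} [L.Structure A] {S : Type}
    (X : (relVarLang (varArity M (blockArity ord))).Structure (A ⊕ S)) {n : ℕ} (e : Fin n ≃ A) :
    enc ord e = (blockTuples n (blockArity ord)).map fun w =>
      decide (@DiagramVocabulary.Bit _ _ _ _ (encVocabulary M ord) (A ⊕ S)
        (expansion M ord A S X) w.1 ((Sum.inl ∘ e) ∘ w.2)) := by
  rw [enc_eq_map_blockTuples]
  refine List.map_congr_left fun w _ => ?_
  refine decide_eq_decide.2 (Iff.trans ?_ (bit_iff M ord A S X w.1 (Sum.inl ∘ e ∘ w.2)).symm)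
  constructor
  · exact fun h => ⟨_, rfl, h⟩
  · rintro ⟨y, hy, h⟩
    rwa [Sum.inl_injective.comp_left hy]

/-- The ordering of `A` that underlies the encoding is part of the guess, so acceptance of some
encoding is what the sentence can express. -/
theorem realize_acceptanceSentence [L.IsRelational] (A : Type c) [L.Structure A] [Finite A] :
    (acceptanceSentence M ord).Realize A ↔ ∃ (n : ℕ) (e : Fin n ≃ A), M.Accepts (enc ord e) := by
  constructor
  · rintro ⟨S, hS, -, X, hX⟩
    let _ := expansion M ord A S X
    have h := ((encVocabulary M ord).realize_sentence (A ⊕ S)).1 hX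
    -- The guessed order restricted to the old elements enumerates `A`, and this enumeration gives
    -- the encoding.
    obtain ⟨n, g, hg⟩ := exists_rank (D := A)
      (lt := fun x y => (encVocabulary M ord).Lt (A ⊕ S) (Sum.inl x) (Sum.inl y))
      (fun x => h.irrefl _) (fun x y z => h.trans _ _ _) fun x y => by
        rcases h.total (Sum.inl x) (Sum.inl y) with h | h | h
        · exact Or.inl h
        · exact Or.inr (Or.inl (Sum.inl_injective h))
        · exact Or.inr (Or.inr h)
    refine ⟨n, g.symm, ?_⟩
    rw [word_eq_enc M ord X]
    refine h.accepts (fun i j hij => (hg _ _).2 (by simpa using hij)) fun x => ?_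
    exact (not_fresh_iff M ord A S X x).trans g.symm.surjective.exists
  · rintro ⟨n, e, hacc⟩
    obtain ⟨N₀, hN₀⟩ := exists_isDiagram (K := blockArity ord) hacc
    -- The new elements alone provide enough times and cells; the extra one keeps `S` nonempty even
    -- if `N₀` is `0`.
    let S := Fin (N₀ + 1)
    let g : A ⊕ S ≃ Fin (n + (N₀ + 1)) := sumEnum e (Equiv.refl _)
    have hword := fun X => word_eq_enc (S := S) M ord X e
    -- The diagram has to exist before the relation variables are interpreted by it. Bits and new
    -- elements are the same under all interpretations, so a trivial one serves to state them.
    let X₀ : (relVarLang (varArity M (blockArity ord))).Structure (A ⊕ S) :=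
      { funMap := fun f _ => isEmptyElim f
        RelMap := fun _ _ => False }
    obtain ⟨cell, pos, h⟩ := hN₀ (by omega) g (e := Sum.inl ∘ e) (fun i => by simp [g])
      (fun x => (not_fresh_iff M ord A S X₀ x).trans e.surjective.exists) (hword X₀)
    obtain ⟨X, hX⟩ := exists_relVar_structure (Finite.equivFin (DiagramVar M (q := p + 2)))
      (diagramArity M (blockArity ord)) (D := A ⊕ S) fun
        | Sum.inl _ => fun t => g (t (0 : Fin 2)) < g (t (1 : Fin 2))
        | Sum.inr (Sum.inl κ) => fun t => cell κ (t (0 : Fin 2)) (t (1 : Fin 2))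
        | Sum.inr (Sum.inr i) => fun t : Fin (blockArity ord i + 1) → A ⊕ S =>
          pos i (Fin.tail t) (t 0)
    refine ⟨S, inferInstance, inferInstance, X, ?_⟩
    let _ := expansion M ord A S X
    refine ((encVocabulary M ord).realize_sentence (A ⊕ S)).2 ?_
    have hlt : (encVocabulary M ord).Lt (A ⊕ S) = fun x y => g x < g y :=
      funext₂ fun x y => propext (hX (Sum.inl ()) _ ![x, y])
    have hcell : (encVocabulary M ord).Cell (A ⊕ S) = cell :=
      funext₃ fun κ t r => propext (hX (Sum.inr (Sum.inl κ)) _ ![t, r])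
    have hpos : (encVocabulary M ord).Pos (A ⊕ S) = pos :=
      funext₃ fun i u x => propext (hX (Sum.inr (Sum.inr i)) _ (Fin.cons x u))
    have hfresh : (encVocabulary M ord).Fresh (A ⊕ S) =
        @DiagramVocabulary.Fresh _ _ _ _ (encVocabulary M ord) (A ⊕ S)
          (expansion M ord A S X₀) :=
      funext fun x => propext (not_iff_not.1
        ((not_fresh_iff M ord A S X x).trans (not_fresh_iff M ord A S X₀ x).symm))
    have hbit : (encVocabulary M ord).Bit (A ⊕ S) =
        @DiagramVocabulary.Bit _ _ _ _ (encVocabulary M ord) (A ⊕ S)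
          (expansion M ord A S X₀) :=
      funext₂ fun i u => propext ((bit_iff M ord A S X i u).trans (bit_iff M ord A S X₀ i u).symm)
    rw [hlt, hcell, hpos, hfresh, hbit]
    exact h

end Main

/-- A class with a semi-decision algorithm is definable in `L_RE`. -/
theorem definable_of_semiDecides (L : FirstOrder.Language.{a, b}) [L.IsRelational] (p : ℕ)
    (ord : Fin p ≃ Σ k, L.Relations k) (C : Set (FinModel.{c} L)) (hC : IsoClosed C)
    (M : TuringMachine) (hM : M.SemiDecides ord C) : Definable C := by
  refine ⟨acceptanceSentence M ord, fun A => ?_⟩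
  rw [realize_acceptanceSentence]
  constructor
  · intro hA
    obtain ⟨n, ⟨e⟩⟩ := Finite.exists_equiv_fin A.carrier
    exact ⟨n, e.symm, (hM _).2 ⟨A, hA, n, e.symm, rfl⟩⟩
  · rintro ⟨n, e, hacc⟩
    obtain ⟨B, hB, m, f, hef⟩ := (hM _).1 hacc
    -- The accepted word is an encoding of both `A` and `B ∈ C`, so the two models are isomorphic.
    exact hC B A (nonempty_equiv_of_enc_eq ord f e hef.symm) hB

end LRE

theorem mainTheorem1 (L : FirstOrder.Language.{v, w}) [L.IsRelational] (p : ℕ)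
    (ord : Fin p ≃ Σ k, L.Relations k) (C : Set (LRE.FinModel.{u} L)) (hC : LRE.IsoClosed C) :
    LRE.Definable C ↔ ∃ M : LRE.TuringMachine, M.SemiDecides ord C :=
  ⟨LRE.exists_semiDecides_of_definable L p ord C,
    fun ⟨M, hM⟩ => LRE.definable_of_semiDecides L p ord C hC M hM⟩
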